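/- **Problems.** Let $\Delta\ge 1$ be an integer and $\Sigma$ a finite non-empty set. An *LCL problem on regular rooted trees* is a triple $\Pi=(\Delta,\Sigma,\mathcal V)$, where $\mathcal V$ is a set of pairs $(\sigma,S)$ with $\sigma\in\Sigma$ and $S$ a multiset of $\Delta$ elements of $\Sigma$. Its instances are the finite rooted trees in which every node has either $0$ or $\Delta$ children. A *solution* on a rooted tree is a labeling $\ell$ of the nodes by $\Sigma$ such that $(\ell(v),\{\ell(u_1),\dots,\ell(u_\Delta)\})\in\mathcal V$ for every node $v$ with $\Delta$ children $u_1,\dots,u_\Delta$ (leaves are unconstrained). **Depth.** For $\Sigma'\subseteq\Sigma$ let $\mathrm{trim}(\Sigma')$ be the set of all $\sigma\in\Sigma'$ such that, for every $i\ge 1$, the complete $\Delta$-ary rooted tree of depth $i$ has a solution that uses only labels of $\Sigma'$ and labels the root with $\sigma$. Let $\mathcal M_{\Sigma'}$ be the digraph on $\Sigma'$ with an edge $(\sigma,\sigma')$ whenever there is $(\sigma,S)\in\mathcal V$ with $\sigma'\in S$, $\sigma\in\Sigma'$ and all elements of $S$ in $\Sigma'$. Let $\mathrm{flexSCC}(\Sigma')$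 be the set of strongly connected components $U$ of $\mathcal M_{\Sigma'}$ that are path-flexible, i.e. there is $K\ge 1$ such that for all $u,v\in U$ and every $m\ge K$ there is a walk of length $m$ from $u$ to $v$ that visits only vertices of $U$. A *good sequence* of length $k\ge 1$ is a sequence $(\Sigma_1^{\mathsf R},\Sigma_1^{\mathsf C},\Sigma_2^{\mathsf R},\dots,\Sigma_{k-1}^{\mathsf C},\Sigma_k^{\mathsf R})$ of subsets of $\Sigma$, with all $\Sigma_i^{\mathsf R}$ non-empty, such that $\Sigma_i^{\mathsf R}=\mathrm{trim}(\Sigma_{i-1}^{\mathsf C})$ for $1\le i\le k$ (where $\Sigma_0^{\mathsf C}=\Sigma$) and $\Sigma_i^{\mathsf C}\in\mathrm{flexSCC}(\Sigma_i^{\mathsf R})$ for $1\le i<k$. The *depth* $d_\Pi$ is the largest length of a good sequence; it is $0$ if there is none and $\infty$ if there are good sequences of every length. **Model.** A *randomized online-LOCAL algorithm* $\mathcal A$ with locality $T\colon\mathbb N\to\mathbb N$ works on an $n$-node rooted tree with node set $\{0,\dots,n-1\}$ (the names serve as unique identifiers, visible to the algorithm; an algorithm may ignore them) as follows. An adversary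 fixes the tree and an order $v_1,\dots,v_n$ of its nodes in advance. When $v_i$ is revealed, $\mathcal A$ irrevocably chooses a label for $v_i$ as a function of $n$, of the sequence $v_1,\dots,v_i$, of the subgraph, with edge orientations, induced by the union of the radius-$T(n)$ neighborhoods of $v_1,\dots,v_i$, and of an infinite stream of fair random bits that is unknown to the adversary; it may remember everything that it has seen and done. It *solves $\Pi$ with high probability* if, for all instances of $\Pi$ except finitely many and for every order of the nodes, it fails to produce a solution with probability at most $1/n$. **Theorem.** Let $\Pi=(\Delta,\Sigma,\mathcal V)$ be an LCL problem on regular rooted trees whose depth $d_\Pi=k$ is finite and positive. Then every randomized online-LOCAL algorithm that solves $\Pi$ with high probability has locality $\Omega(n^{1/k})$. Precisely, there is a constant $c>0$, depending only on $\Pi$, such that for every randomized online-LOCAL algorithm with locality $T$ that solves $\Pi$ with high probability, $T(n)\ge c\,n^{1/k}$ holds for all sufficiently large $n$ with $n\equiv 1\pmod\Delta$ (only for such $n$ do instances with $n$ nodes exist). -/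

import Mathlib

open MeasureTheory Filter

/-- A rooted tree on the vertex set `V`, given by its parent map. The root is the only vertex
that is its own parent, and every vertex reaches the root by iterating the parent map. (Mathlib's
`RootedTree` bundles a vertex type with an order; here trees on a prescribed vertex set are needed.) -/
structure RootedTreeOn (V : Type*) where
  root : V
  parent : V → V
  parent_root : parent root = root
  reaches_root : ∀ v, ∃ m : ℕ, parent^[m] v = root

namespace RootedTreeOn

variable {V : Type*} (G : RootedTreeOn V)

/-- The set of children of a vertex. -/
def children (v : V) : Set V := {u | u ≠ G.root ∧ G.parent u = v}

/-- Every vertex has either no child (it is a leaf) or exactly `Δ` children. -/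
def IsRegular (Δ : ℕ) : Prop :=
  ∀ v, (G.children v).ncard = 0 ∨ (G.children v).ncard = Δ

/-- The underlying undirected graph. -/
def graph : SimpleGraph V := SimpleGraph.fromRel fun u v => G.parent u = v

/-- The radius-`r` neighborhood of a vertex in the underlying undirected graph. -/
def ball (v : V) (r : ℕ) : Set V := {u | ∃ p : G.graph.Walk v u, p.length ≤ r}

end RootedTreeOn

/-- The complete `Δ`-ary rooted tree of depth `i`: the vertices are the words of length at most
`i` over `Fin Δ`, the root is the empty word and the children of `w` are the words `j :: w`. -/
def completeTree (Δ i : ℕ) : RootedTreeOn {w : List (Fin Δ) // w.length ≤ i} where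
  root := ⟨[], Nat.zero_le _⟩
  parent w := ⟨w.1.tail, by have := w.2; rw [List.length_tail]; omega⟩
  parent_root := rfl
  reaches_root := by
    rintro ⟨w, hw⟩
    induction w with
    | nil => exact ⟨0, rfl⟩
    | cons a w ih =>
      obtain ⟨m, hm⟩ := ih (by rw [List.length_cons] at hw; omega)
      exact ⟨m + 1, hm⟩

/-- An LCL problem `(Δ, L, 𝒱)` on regular rooted trees, with label set `L`: the constraints `𝒱`
are a set of pairs of a label (of a node) and a multiset of `Δ` labels (of its children). -/
structure RootedLCL (Δ : ℕ) (L : Type*) where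
  constraints : Set (L × Sym L Δ)

/-- The multiset `{f 0, …, f (Δ - 1)}`. -/
def multisetOf {Δ : ℕ} {L : Type*} (f : Fin Δ → L) : Sym L Δ :=
  ⟨(Finset.univ : Finset (Fin Δ)).val.map f, by simp⟩

namespace RootedLCL

variable {Δ : ℕ} {L : Type*} (P : RootedLCL Δ L)

/-- `ℓ` is a solution on the tree `G`: for each node `v` with `Δ` children `u 0, …, u (Δ - 1)`,
the label of `v` with the multiset of the labels of its children is allowed. -/
def IsSolution {V : Type*} (G : RootedTreeOn V) (ℓ : V → L) : Prop :=
  ∀ (v : V) (u : Fin Δ → V), Function.Injective u → Set.range u = G.children v →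
    (ℓ v, multisetOf (ℓ ∘ u)) ∈ P.constraints

/-- The restriction of the problem to a subset `S` of the labels. The label type is kept; labels
outside `S` appear in no constraint. -/
def restrict (S : Set L) : RootedLCL Δ L where
  constraints := {p | p ∈ P.constraints ∧ p.1 ∈ S ∧ ∀ x ∈ p.2, x ∈ S}

/-- The edge relation of the automaton of the problem. -/
def automaton (a b : L) : Prop := ∃ S : Sym L Δ, (a, S) ∈ P.constraints ∧ b ∈ S

/-- `trim S`: the labels `a ∈ S` such that every complete tree of positive depth has a solution
that uses only labels of `S` and labels the root with `a`. -/
def trim (S : Set L) : Set L :=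
  {a | a ∈ S ∧ ∀ i : ℕ, 0 < i → ∃ ℓ : {w : List (Fin Δ) // w.length ≤ i} → L,
    P.IsSolution (completeTree Δ i) ℓ ∧ ℓ (completeTree Δ i).root = a ∧ ∀ w, ℓ w ∈ S}

end RootedLCL

/-- In the digraph `M` there is a walk of length `m` from `a` to `b` that visits only `U`. -/
def HasWalk {L : Type*} (M : L → L → Prop) (U : Set L) (m : ℕ) (a b : L) : Prop :=
  ∃ w : ℕ → L, w 0 = a ∧ w m = b ∧ (∀ i ≤ m, w i ∈ U) ∧ ∀ i < m, M (w i) (w (i + 1))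

/-- Path-flexibility: between any two vertices of `U` there are walks inside `U` of every
sufficiently large length. -/
def PathFlexible {L : Type*} (M : L → L → Prop) (U : Set L) : Prop :=
  ∃ K : ℕ, 0 < K ∧ ∀ a ∈ U, ∀ b ∈ U, ∀ m, K ≤ m → HasWalk M U m a b

/-- `U` is a strongly connected component of the digraph `M` with vertex set `S`. -/
def IsSCC {L : Type*} (M : L → L → Prop) (S U : Set L) : Prop :=
  ∃ a ∈ S, U = {b | b ∈ S ∧ Relation.ReflTransGen M a b ∧ Relation.ReflTransGen M b a}

namespace RootedLCL

variable {Δ : ℕ} {L : Type*} (P : RootedLCL Δ L)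

/-- The path-flexible strongly connected components of the automaton of the restriction of the
problem to `S`. -/
def flexSCC (S : Set L) : Set (Set L) :=
  {U | IsSCC (P.restrict S).automaton S U ∧ PathFlexible (P.restrict S).automaton U}

/-- `(R 1, C 1, R 2, C 2, …, R k)` is a good sequence of length `k`, where `C 0` is the set of all
labels. The other values of `R` and `C` play no role. -/
structure IsGoodSequence (k : ℕ) (R C : ℕ → Set L) : Prop where
  pos : 0 < k
  zero : C 0 = Set.univ
  trim_eq : ∀ i < k, R (i + 1) = P.trim (C i)
  mem_flexSCC : ∀ i, 0 < i → i < k → C i ∈ P.flexSCC (R i)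
  nonempty : ∀ i, 0 < i → i ≤ k → (R i).Nonempty

/-- The depth: the largest length of a good sequence, `0` if there is no good sequence, and `⊤`
if there are good sequences of every length. -/
noncomputable def depth : ℕ∞ :=
  ⨆ (k : ℕ) (_ : ∃ R C, P.IsGoodSequence k R C), (k : ℕ∞)

end RootedLCL

/-- What an online algorithm knows when it has to label a node of an `n`-node rooted tree: the
nodes revealed so far, in order (the last one is to be labeled now), the set of the nodes seen so
far, and the arcs (from child to parent) among these nodes. The vertex names in `Fin n` are visible
and play the role of unique identifiers. -/
@[ext]
structure View (n : ℕ) where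
  revealed : List (Fin n)
  seen : Set (Fin n)
  arc : Fin n → Fin n → Prop

/-- The view with locality `t` when the node `σ i` is revealed: the subgraph induced by the
radius-`t` neighborhoods of `σ 0, …, σ i`. All earlier views can be recovered from it. -/
def RootedTreeOn.view {n : ℕ} (G : RootedTreeOn (Fin n)) (t : ℕ) (σ : Equiv.Perm (Fin n))
    (i : Fin n) : View n where
  revealed := (List.ofFn σ).take (i + 1)
  seen := {u | ∃ j ≤ i, u ∈ G.ball (σ j) t}
  arc u v := (∃ j ≤ i, u ∈ G.ball (σ j) t) ∧ (∃ j ≤ i, v ∈ G.ball (σ j) t) ∧ u ∈ G.children v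

/-- A randomized online-LOCAL algorithm with output labels in `L` and locality `locality n` on
trees with `n` nodes. The label of the current node is a function of `n`, of the current view and of
an infinite stream of random bits. Global memory needs no separate component: earlier views,
and with the random bits also the earlier outputs, are determined by the present view. -/
structure RandOnlineLocalAlgorithm (L : Type*) where
  locality : ℕ → ℕ
  output : (n : ℕ) → View n → (ℕ → Bool) → L
  measurable_output : ∀ n (v : View n) (a : L), MeasurableSet {ω | output n v ω = a}

/-- The distribution of an infinite stream of independent fair random bits. -/
noncomputable def randomBits : Measure (ℕ → Bool) :=
  Measure.infinitePi fun _ => (PMF.uniformOfFintype Bool).toMeasure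

namespace RandOnlineLocalAlgorithm

variable {L : Type*} (A : RandOnlineLocalAlgorithm L)

/-- The labeling produced on the tree `G` when the nodes are revealed in the order
`σ 0, σ 1, …` and the random bits are `ω`. -/
def run {n : ℕ} (G : RootedTreeOn (Fin n)) (σ : Equiv.Perm (Fin n)) (ω : ℕ → Bool) : Fin n → L :=
  fun v => A.output n (G.view (A.locality n) σ (σ.symm v)) ω

/-- The algorithm solves the problem with high probability: for all regular trees except finitely
many, and every order of the nodes fixed in advance, it fails with probability at most `1 / n`. -/
def Solves {Δ : ℕ} (P : RootedLCL Δ L) : Prop :=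
  {G : Σ n : ℕ, RootedTreeOn (Fin n) | G.2.IsRegular Δ ∧
    ¬ ∀ σ : Equiv.Perm (Fin G.1),
      randomBits {ω | ¬ P.IsSolution G.2 (A.run G.2 σ ω)} ≤ 1 / (G.1 : ENNReal)}.Finite

end RandOnlineLocalAlgorithm

/-! ### Depth, ancestors and descendants in rooted trees. -/

namespace RootedTreeOn

variable {V : Type*} (G : RootedTreeOn V)

/-! An algorithm whose locality `t` is below `c * n ^ (1 / k)` yields a good sequence of length `k +
1`, which contradicts the depth `k`.

The adversary uses a tree with paths of `2 * s + 1` vertices, `s = t + 3`, on the levels `0, …, k -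
1`. Complete trees of constant depth `D` hang from the path vertices; the trees of level `i + 1`
continue with paths of level `i`, those of level `0` end in leaves. A spine passes through one path
of each level and ends in a tree of level `k`. Each level multiplies the size by `O(s)`, so the tree
fits into `n` vertices (`exists_isScaffold`). `D` is chosen such that labels from `S` in the `D`
layers below a vertex force its label into `trim S` (`exists_trim_bound`).

The centers of the paths are revealed first, by increasing level. A rotation exchanges two
consecutive segments of a descending path. Rotations of level `i` cut at ends of paths of level `i`,
out of sight of all centers of level at most `i`, which therefore keep their labels
(`IsLevelRotation.congr`). The tree and its rotations are at most `n - 1` trees, each failing with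
probability at most `1 / n`; hence one random string succeeds on all of them
(`exists_forall_notMem`).

Fix this string. Put `C 0 = univ`, and let `C (i + 1)` be the component of the label of the spine
center of level `i` in the automaton on `trim (C i)`. By induction, the labels between the spine
center and the other centers of level `i` lie in `C (i + 1)` (`label_mem_components`): the tree
gives a walk from the label of the spine center through the given label to that of another center,
and the rotation that moves the spine center below this other center gives a walk back. A further
rotation removes one vertex from the path below the spine center, which gives closed walks of two
consecutive lengths, so the component is path-flexible. The tree of level `k` at the end of the
spine shows that `trim (C k)` is non-empty, and the good sequence has length `k + 1`
(`exists_isGoodSequence`). -/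

/-- The distance of a vertex to the root. -/
noncomputable def depth (v : V) : ℕ := by
  classical exact Nat.find (G.reaches_root v)

theorem iterate_depth (v : V) : G.parent^[G.depth v] v = G.root := by
  classical exact Nat.find_spec (G.reaches_root v)

theorem depth_le {v : V} {m : ℕ} (h : G.parent^[m] v = G.root) : G.depth v ≤ m := by
  classical exact Nat.find_min' (G.reaches_root v) h

theorem depth_parent {v : V} (hv : v ≠ G.root) : G.depth v = G.depth (G.parent v) + 1 := by
  apply le_antisymm
  · exact G.depth_le (by rw [Function.iterate_succ_apply, G.iterate_depth])
  · have h := G.iterate_depth v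
    rcases hm : G.depth v with _ | m
    · rw [hm] at h
      exact absurd h hv
    · rw [hm, Function.iterate_succ_apply] at h
      exact Nat.succ_le_succ (G.depth_le h)

theorem iterate_root (m : ℕ) : G.parent^[m] G.root = G.root :=
  Function.iterate_fixed G.parent_root m

/-- The root is its own parent, so the count is exact only when the climb does not end there. -/
theorem depth_iterate {v a : V} {m : ℕ} (h : G.parent^[m] v = a) (ha : a ≠ G.root) :
    G.depth v = G.depth a + m := by
  induction m generalizing v with
  | zero => simp_all
  | succ m ih =>
    have hv : v ≠ G.root := by
      rintro rfl
      exact ha (by rw [← h, G.iterate_root])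
    rw [Function.iterate_succ_apply] at h
    rw [G.depth_parent hv, ih h]
    omega

theorem mem_children {u v : V} : u ∈ G.children v ↔ u ≠ G.root ∧ G.parent u = v := Iff.rfl

theorem depth_child {u v : V} (h : u ∈ G.children v) : G.depth u = G.depth v + 1 := by
  rw [G.depth_parent h.1, h.2]

/-- Following children inside a set, one arrives at an exit of the set. -/
theorem exists_descendant [Finite V] {M E : V → Prop}
    (h : ∀ v, M v → ¬ E v → ∃ u ∈ G.children v, M u) {v : V} (hv : M v) :
    ∃ u m, E u ∧ M u ∧ G.parent^[m] u = v ∧ ∀ j ≤ m, M (G.parent^[j] u) := by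
  obtain ⟨b, hb⟩ : BddAbove (Set.range G.depth) := (Set.finite_range _).bddAbove
  have hb' : ∀ v, G.depth v ≤ b := fun v => hb ⟨v, rfl⟩
  induction hk : b - G.depth v using Nat.strong_induction_on generalizing v with
  | _ c ih =>
    by_cases hE : E v
    · exact ⟨v, 0, hE, hv, rfl, by simpa using hv⟩
    · obtain ⟨u, hu, hMu⟩ := h v hv hE
      have hd := G.depth_child hu
      have := hb' u
      obtain ⟨w, m, hEw, hMw, hw, hj⟩ := ih (b - G.depth u) (by omega) hMu rfl
      have hw' : G.parent^[m + 1] w = v := by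
        rw [Function.iterate_succ_apply', hw, hu.2]
      refine ⟨w, m + 1, hEw, hMw, hw', fun j hjm => ?_⟩
      rcases Nat.lt_or_ge m j with h1 | h1
      · obtain rfl : j = m + 1 := by omega
        rwa [hw']
      · exact hj j h1

/-- Following parents inside a set, one arrives at the top of the set. -/
theorem exists_ancestor {M : V → Prop} {x : V}
    (h : ∀ v, M v → v ≠ x → v ≠ G.root ∧ M (G.parent v)) {v : V} (hv : M v) :
    ∃ m, G.parent^[m] v = x ∧ ∀ j ≤ m, M (G.parent^[j] v) := by
  induction hk : G.depth v using Nat.strong_induction_on generalizing v with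
  | _ c ih =>
    by_cases hx : v = x
    · exact ⟨0, hx, by simpa using hv⟩
    · obtain ⟨hr, hM⟩ := h v hv hx
      obtain ⟨m, hm, hj⟩ := ih (G.depth (G.parent v)) (by rw [← hk, G.depth_parent hr]; omega) hM rfl
      refine ⟨m + 1, hm, fun j hjm => ?_⟩
      rcases j with _ | j
      · exact hv
      · exact hj j (by omega)

/-! ### Rotations: exchanging two consecutive segments of a descending path. -/

section Rotation

variable [DecidableEq V] {a p q : V}

/-- The 3-cycle `p ↦ a ↦ q ↦ p`. -/
def cycle (a p q : V) : Equiv.Perm V := Equiv.swap p q * Equiv.swap a p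

theorem cycle_left : cycle a p q a = q := by
  simp [cycle]

theorem cycle_mid (hap : a ≠ p) (haq : a ≠ q) : cycle a p q p = a := by
  simp [cycle, Equiv.swap_apply_of_ne_of_ne hap haq]

theorem cycle_right (haq : a ≠ q) (hpq : p ≠ q) : cycle a p q q = p := by
  simp [cycle, Equiv.swap_apply_of_ne_of_ne haq.symm hpq.symm]

theorem cycle_other {v : V} (ha : v ≠ a) (hp : v ≠ p) (hq : v ≠ q) : cycle a p q v = v := by
  simp [cycle, Equiv.swap_apply_of_ne_of_ne, ha, hp, hq]

/-- `H` arises from `G` by exchanging the part of `G` between `a` and `p` with the part between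
`p` and `q`, where `a` is above `p` and `p` is above `q`. -/
structure IsRotation (H : RootedTreeOn V) (a p q : V) : Prop where
  ne_root : a ≠ G.root
  above_left : ∃ m, 0 < m ∧ G.parent^[m] p = a
  above_right : ∃ m, 0 < m ∧ G.parent^[m] q = p
  root_eq : H.root = G.root
  parent_eq : ∀ v, H.parent v = G.parent (cycle a p q v)

/-- Only reachability of the root needs an argument. The vertex `p` now hangs where `a` did. The
vertex `a` hangs below the old parent of `q`, from which the climb leads to `p`; the vertex `q`
hangs below the old parent of `p`, from which it leads to `a`. -/
theorem exists_isRotation (ha : a ≠ G.root) (hp : ∃ m, 0 < m ∧ G.parent^[m] p = a)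
    (hq : ∃ m, 0 < m ∧ G.parent^[m] q = p) : ∃ H, G.IsRotation H a p q := by
  obtain ⟨α, hα, hpa⟩ := hp
  obtain ⟨β, hβ, hqp⟩ := hq
  have hp0 : p ≠ G.root := by
    rintro rfl
    exact ha (by rw [← hpa, G.iterate_root])
  have hq0 : q ≠ G.root := by
    rintro rfl
    exact hp0 (by rw [← hqp, G.iterate_root])
  have hdp := G.depth_iterate hpa ha
  have hdq := G.depth_iterate hqp hp0
  have hap : a ≠ p := by rintro rfl; omega
  have haq : a ≠ q := by rintro rfl; omega
  have hpq : p ≠ q := by rintro rfl; omega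
  set f : V → V := fun v => G.parent (cycle a p q v) with hf
  have fother : ∀ v, v ≠ a → v ≠ p → v ≠ q → f v = G.parent v := fun v h1 h2 h3 => by
    rw [hf]
    simp only [cycle_other h1 h2 h3]
  have fa : f a = G.parent q := by simp only [hf, cycle_left]
  have fp : f p = G.parent a := by simp only [hf, cycle_mid hap haq]
  have fq : f q = G.parent p := by simp only [hf, cycle_right haq hpq]
  let Good : V → Prop := fun v => ∃ m, f^[m] v = G.root
  have good_step : ∀ v, Good (f v) → Good v := fun v ⟨m, hm⟩ => ⟨m + 1, hm⟩
  have da := G.depth_parent ha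
  have dp := G.depth_parent hp0
  have dq := G.depth_parent hq0
  have good_root : Good G.root := ⟨0, rfl⟩
  -- Away from the three cut points the new parent map is the old one, so the old climb can be
  -- followed up to the root or to the first cut point met.
  have climb : ∀ d v, G.depth v = d → (∀ j, G.parent^[j] v ≠ G.root →
      G.parent^[j] v = a ∨ G.parent^[j] v = p ∨ G.parent^[j] v = q → Good (G.parent^[j] v)) →
      Good v := by
    intro d
    induction d with
    | zero =>
      intro v hv _
      have := G.iterate_depth v
      rw [hv] at this
      exact ⟨0, this⟩
    | succ d ih =>
      intro v hv h
      by_cases hr : v = G.root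
      · exact hr ▸ good_root
      by_cases hs : v = a ∨ v = p ∨ v = q
      · exact h 0 hr hs
      · push Not at hs
        apply good_step
        rw [fother v hs.1 hs.2.1 hs.2.2]
        refine ih _ ?_ fun j => h (j + 1)
        have := G.depth_parent hr
        omega
  have low : ∀ v, G.depth v < G.depth a → Good v := by
    intro v hv
    refine climb _ v rfl fun j hj hs => ?_
    have := G.depth_iterate (v := v) (m := j) rfl hj
    exfalso
    rcases hs with h | h | h <;> rw [h] at this <;> omega
  have gp : Good p := good_step _ (by rw [fp]; exact low _ (by omega))
  have segment : ∀ m v x, x ≠ G.root → G.parent^[m] v = x → Good x →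
      (∀ y, (y = a ∨ y = p ∨ y = q) → y ≠ x → G.depth y < G.depth x ∨ G.depth x + m < G.depth y) →
      Good v := by
    intro m
    induction m with
    | zero => rintro v x - rfl h -; exact h
    | succ m ih =>
      intro v x hx hv hg hy
      have hd := G.depth_iterate hv hx
      by_cases hs : v = a ∨ v = p ∨ v = q
      · have := hy v hs (by rintro rfl; omega)
        omega
      · push Not at hs
        apply good_step
        rw [fother v hs.1 hs.2.1 hs.2.2]
        refine ih _ x hx hv hg fun y h1 h2 => ?_
        have := hy y h1 h2
        omega
  have ga : Good a := by
    apply good_step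
    rw [fa]
    obtain ⟨m, rfl⟩ : ∃ m, β = m + 1 := ⟨β - 1, by omega⟩
    refine segment m _ p hp0 hqp gp ?_
    rintro y (rfl | rfl | rfl) h <;> first | omega | exact absurd rfl h
  have gq : Good q := by
    apply good_step
    rw [fq]
    obtain ⟨m, rfl⟩ : ∃ m, α = m + 1 := ⟨α - 1, by omega⟩
    refine segment m _ a ha hpa ga ?_
    rintro y (rfl | rfl | rfl) h <;> first | omega | exact absurd rfl h
  refine ⟨⟨G.root, f, ?_, fun v => climb _ v rfl fun j _ hs => ?_⟩, ha, ⟨α, hα, hpa⟩,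
    ⟨β, hβ, hqp⟩, rfl, fun v => rfl⟩
  · rw [fother _ ha.symm hp0.symm hq0.symm, G.parent_root]
  · rcases hs with h | h | h <;> rw [h] <;> assumption

namespace IsRotation

variable {G} {H : RootedTreeOn V} (h : G.IsRotation H a p q)

include h

theorem ne_root_mid : p ≠ G.root := by
  obtain ⟨m, -, hm⟩ := h.above_left
  rintro rfl
  exact h.ne_root (by rw [← hm, G.iterate_root])

theorem ne_root_right : q ≠ G.root := by
  obtain ⟨m, -, hm⟩ := h.above_right
  rintro rfl
  exact h.ne_root_mid (by rw [← hm, G.iterate_root])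

theorem depth_lt_left : G.depth a < G.depth p := by
  obtain ⟨m, h0, hm⟩ := h.above_left
  have := G.depth_iterate hm h.ne_root
  omega

theorem depth_lt_right : G.depth p < G.depth q := by
  obtain ⟨m, h0, hm⟩ := h.above_right
  have := G.depth_iterate hm h.ne_root_mid
  omega

theorem ne_left_mid : a ≠ p := by
  have := h.depth_lt_left
  rintro rfl
  omega

theorem ne_mid_right : p ≠ q := by
  have := h.depth_lt_right
  rintro rfl
  omega

theorem ne_left_right : a ≠ q := by
  have := h.depth_lt_right
  have := h.depth_lt_left
  rintro rfl
  omega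

theorem parent_left : H.parent a = G.parent q := by
  rw [h.parent_eq, cycle_left]

theorem parent_mid : H.parent p = G.parent a := by
  rw [h.parent_eq, cycle_mid h.ne_left_mid h.ne_left_right]

theorem parent_right : H.parent q = G.parent p := by
  rw [h.parent_eq, cycle_right h.ne_left_right h.ne_mid_right]

theorem parent_other {v : V} (ha : v ≠ a) (hp : v ≠ p) (hq : v ≠ q) : H.parent v = G.parent v := by
  rw [h.parent_eq, cycle_other ha hp hq]

theorem iterate_other {v : V} {m : ℕ}
    (hv : ∀ j < m, G.parent^[j] v ≠ a ∧ G.parent^[j] v ≠ p ∧ G.parent^[j] v ≠ q) :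
    H.parent^[m] v = G.parent^[m] v := by
  induction m with
  | zero => rfl
  | succ m ih =>
    rw [Function.iterate_succ_apply', Function.iterate_succ_apply',
      ih fun j hj => hv j (by omega)]
    obtain ⟨h1, h2, h3⟩ := hv m (by omega)
    exact h.parent_other h1 h2 h3

theorem cycle_root : cycle a p q G.root = G.root :=
  cycle_other h.ne_root.symm h.ne_root_mid.symm h.ne_root_right.symm

/-- The cycle fixes the root and turns the new parent map into the old one; hence it matches sets of
children, and their sizes do not change. -/
theorem children_eq (v : V) : H.children v = (cycle a p q) ⁻¹' G.children v := by
  ext u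
  rw [mem_children, Set.mem_preimage, mem_children, h.root_eq, h.parent_eq]
  have : cycle a p q u = G.root ↔ u = G.root :=
    ⟨fun e => (cycle a p q).injective (e.trans h.cycle_root.symm), fun e => by rw [e, h.cycle_root]⟩
  rw [Ne, Ne, this]

theorem isRegular {Δ : ℕ} (hG : G.IsRegular Δ) : H.IsRegular Δ := by
  intro v
  have : (H.children v).ncard = (G.children v).ncard := by
    rw [h.children_eq, ← Equiv.image_symm_eq_preimage]
    exact Set.ncard_image_of_injective _ (Equiv.injective _)
  rw [this]
  exact hG v

/-- A rotation inside a set of vertices permutes the vertices of the set. -/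
theorem cycle_mem {X : V → Prop} (ha : X a) (hp : X p) (hq : X q) (v : V) :
    X (cycle a p q v) ↔ X v := by
  by_cases h1 : v = a
  · subst h1; simp [cycle_left, ha, hq]
  by_cases h2 : v = p
  · subst h2; simp [cycle_mid h.ne_left_mid h.ne_left_right, ha, hp]
  by_cases h3 : v = q
  · subst h3; simp [cycle_right h.ne_left_right h.ne_mid_right, hp, hq]
  rw [cycle_other h1 h2 h3]

end IsRotation

end Rotation

/-! ### Balls, and the locality of rotations. -/

section Ball

theorem mem_ball_self (v : V) (r : ℕ) : v ∈ G.ball v r := ⟨.nil, Nat.zero_le _⟩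

theorem mem_ball_zero {u v : V} : u ∈ G.ball v 0 ↔ u = v := by
  constructor
  · rintro ⟨p, hp⟩
    exact (SimpleGraph.Walk.eq_of_length_eq_zero (Nat.le_zero.1 hp)).symm
  · rintro rfl
    exact G.mem_ball_self u 0

theorem mem_ball_succ {u v : V} {r : ℕ} :
    u ∈ G.ball v (r + 1) ↔ u ∈ G.ball v r ∨ ∃ w ∈ G.ball v r, G.graph.Adj w u := by
  constructor
  · rintro ⟨p, hp⟩
    by_cases hn : p.Nil
    · left
      obtain rfl := hn.eq
      exact G.mem_ball_self _ _
    · right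
      refine ⟨p.penultimate, ⟨p.dropLast, ?_⟩, p.adj_penultimate hn⟩
      have := SimpleGraph.Walk.length_dropLast_add_one hn
      omega
  · rintro (⟨p, hp⟩ | ⟨w, ⟨p, hp⟩, hw⟩)
    · exact ⟨p, by omega⟩
    · exact ⟨p.concat hw, by rw [SimpleGraph.Walk.length_concat]; omega⟩

theorem adj_iff {u v : V} : G.graph.Adj u v ↔ u ≠ v ∧ (G.parent u = v ∨ G.parent v = u) := by
  rw [graph, SimpleGraph.fromRel_adj]

/-- Vertices at bounded distance have a common ancestor close by. -/
theorem exists_common_ancestor {x u : V} {r : ℕ} (h : u ∈ G.ball x r) :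
    ∃ i j, i + j ≤ r ∧ G.parent^[i] x = G.parent^[j] u := by
  induction r generalizing u with
  | zero =>
    rw [mem_ball_zero] at h
    exact ⟨0, 0, le_rfl, by rw [h]⟩
  | succ r ih =>
    rcases G.mem_ball_succ.1 h with h | ⟨w, hw, hwu⟩
    · obtain ⟨i, j, hij, e⟩ := ih h
      exact ⟨i, j, by omega, e⟩
    · obtain ⟨i, j, hij, e⟩ := ih hw
      rcases (G.adj_iff.1 hwu).2 with h1 | h1
      · rcases j with _ | j
        · exact ⟨i + 1, 0, by omega, by rw [Function.iterate_succ_apply', e]; exact h1⟩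
        · refine ⟨i, j, by omega, ?_⟩
          rw [e, Function.iterate_succ_apply, h1]
      · exact ⟨i, j + 1, by omega, by rw [e, Function.iterate_succ_apply, h1]⟩

theorem parent_mem_ball {x u : V} {r : ℕ} (h : u ∈ G.ball x r) : G.parent u ∈ G.ball x (r + 1) := by
  rw [mem_ball_succ]
  by_cases hu : u = G.parent u
  · left
    rwa [← hu]
  · exact Or.inr ⟨u, h, G.adj_iff.2 ⟨hu, Or.inl rfl⟩⟩

theorem ball_mono {x : V} {r r' : ℕ} (h : r ≤ r') : G.ball x r ⊆ G.ball x r' :=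
  fun _ ⟨p, hp⟩ => ⟨p, hp.trans h⟩

/-- Two trees that agree around all vertices of a ball have the same ball. -/
theorem ball_congr {H : RootedTreeOn V} {x : V} {r : ℕ}
    (h : ∀ z ∈ G.ball x r, ∀ u, G.graph.Adj z u ↔ H.graph.Adj z u) : H.ball x r = G.ball x r := by
  induction r with
  | zero =>
    ext u
    rw [mem_ball_zero, mem_ball_zero]
  | succ r ih =>
    have ih' := ih fun z hz => h z (G.ball_mono (Nat.le_succ r) hz)
    ext u
    rw [mem_ball_succ, mem_ball_succ, ih']
    refine or_congr Iff.rfl (exists_congr fun w => and_congr_right fun hw => ?_)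
    exact (h w (G.ball_mono (Nat.le_succ r) hw) u).symm

-- A rotation moves only the edges above `a`, `p` and `q`. Their endpoints, old and new, are these
-- vertices and their old parents; every other vertex keeps its neighbors.
variable {G} in
theorem IsRotation.adj_iff [DecidableEq V] {H : RootedTreeOn V} {a p q z : V}
    (h : G.IsRotation H a p q) (ha : z ≠ a) (hp : z ≠ p) (hq : z ≠ q) (ha' : z ≠ G.parent a)
    (hp' : z ≠ G.parent p) (hq' : z ≠ G.parent q) (u : V) :
    G.graph.Adj z u ↔ H.graph.Adj z u := by
  rw [G.adj_iff, H.adj_iff, h.parent_other ha hp hq]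
  have : G.parent u = z ↔ H.parent u = z := by
    by_cases h1 : u = a
    · subst h1; rw [h.parent_left]; simp [ha'.symm, hq'.symm]
    by_cases h2 : u = p
    · subst h2; rw [h.parent_mid]; simp [ha'.symm, hp'.symm]
    by_cases h3 : u = q
    · subst h3; rw [h.parent_right]; simp [hq'.symm, hp'.symm]
    rw [h.parent_other h1 h2 h3]
  rw [this]

variable {G} in
theorem IsRotation.children_congr [DecidableEq V] {H : RootedTreeOn V} {a p q z : V}
    (h : G.IsRotation H a p q) (ha' : z ≠ G.parent a)
    (hp' : z ≠ G.parent p) (hq' : z ≠ G.parent q) : H.children z = G.children z := by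
  ext u
  rw [H.mem_children, G.mem_children, h.root_eq]
  refine and_congr Iff.rfl ?_
  by_cases h1 : u = a
  · subst h1; rw [h.parent_left]; simp [ha'.symm, hq'.symm]
  by_cases h2 : u = p
  · subst h2; rw [h.parent_mid]; simp [ha'.symm, hp'.symm]
  by_cases h3 : u = q
  · subst h3; rw [h.parent_right]; simp [hq'.symm, hp'.symm]
  rw [h.parent_other h1 h2 h3]

end Ball

end RootedTreeOn

/-! ### Walks in digraphs and path-flexible components. -/

section Walks

variable {L : Type*} {M : L → L → Prop}

/-- In the digraph `M` there is a walk of length `m` from `a` to `b`. -/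
def Steps (M : L → L → Prop) : ℕ → L → L → Prop
  | 0, a, b => a = b
  | m + 1, a, b => ∃ c, M a c ∧ Steps M m c b

theorem Steps.trans {m m' : ℕ} {a b c : L} (h : Steps M m a b) (h' : Steps M m' b c) :
    Steps M (m + m') a c := by
  induction m generalizing a with
  | zero =>
    obtain rfl : a = b := h
    rwa [Nat.zero_add]
  | succ m ih =>
    obtain ⟨d, hd, h⟩ := h
    rw [Nat.succ_add]
    exact ⟨d, hd, ih h⟩

theorem Steps.reflTransGen {m : ℕ} {a b : L} (h : Steps M m a b) :
    Relation.ReflTransGen M a b := by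
  induction m generalizing a with
  | zero =>
    obtain rfl : a = b := h
    rfl
  | succ m ih =>
    obtain ⟨d, hd, h⟩ := h
    exact (ih h).head hd

theorem exists_steps {a b : L} (h : Relation.ReflTransGen M a b) : ∃ m, Steps M m a b := by
  induction h using Relation.ReflTransGen.head_induction_on with
  | refl => exact ⟨0, rfl⟩
  | head h _ ih =>
    obtain ⟨m, hm⟩ := ih
    exact ⟨m + 1, _, h, hm⟩

theorem Steps.mul {m : ℕ} {a : L} (h : Steps M m a a) (x : ℕ) : Steps M (x * m) a a := by
  induction x with
  | zero =>
    rw [Nat.zero_mul]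
    rfl
  | succ x ih =>
    rw [Nat.succ_mul]
    exact ih.trans h

/-- Closed walks of two consecutive lengths give closed walks of all large lengths. -/
theorem Steps.closed_of_le {m N : ℕ} {a : L} (h : Steps M m a a) (h' : Steps M (m + 1) a a)
    (hN : m * m ≤ N) : Steps M N a a := by
  rcases Nat.eq_zero_or_pos m with rfl | hm
  · simpa using h'.mul N
  · have h1 : m ≤ N / m := (Nat.le_div_iff_mul_le hm).2 hN
    have h2 := Nat.mod_lt N hm
    have h3 := Nat.div_add_mod N m
    -- Of the `N / m` closed walks of length `m`, the remainder `N % m` many are replaced by walks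
    -- longer by one. There are enough of them, as `N % m < m ≤ N / m`.
    obtain ⟨x, hx⟩ : ∃ x, N / m = x + N % m := ⟨N / m - N % m, by omega⟩
    have h4 : N = x * m + (N % m) * (m + 1) := by
      generalize N % m = y at *
      rw [hx] at h3
      rw [← h3]
      ring
    rw [h4]
    exact (h.mul x).trans (h'.mul _)

theorem Steps.exists_fun {m : ℕ} {a b : L} (h : Steps M m a b) :
    ∃ w : ℕ → L, w 0 = a ∧ w m = b ∧ ∀ i < m, M (w i) (w (i + 1)) := by
  induction m generalizing a with
  | zero => exact ⟨fun _ => a, rfl, h, fun i hi => absurd hi (Nat.not_lt_zero i)⟩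
  | succ m ih =>
    obtain ⟨d, hd, h⟩ := h
    obtain ⟨w, h0, hm, hw⟩ := ih h
    refine ⟨fun i => i.casesOn a w, rfl, hm, fun i hi => ?_⟩
    rcases i with _ | i
    · simpa [h0] using hd
    · exact hw i (by omega)

/-- The strongly connected component of `a` in the digraph `M` on the vertex set `S`. -/
def sccOf (M : L → L → Prop) (S : Set L) (a : L) : Set L :=
  {b | b ∈ S ∧ Relation.ReflTransGen M a b ∧ Relation.ReflTransGen M b a}

/-- Each vertex of a walk between two members of a component is reachable from the component and
reaches it, so the walk never leaves it. -/
theorem Steps.hasWalk {S : Set L} (hM : ∀ x y, M x y → y ∈ S) {c a b : L} {m : ℕ}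
    (ha : a ∈ sccOf M S c) (hb : b ∈ sccOf M S c) (h : Steps M m a b) :
    HasWalk M (sccOf M S c) m a b := by
  obtain ⟨w, h0, hm, hw⟩ := h.exists_fun
  have hfrom : ∀ i ≤ m, Relation.ReflTransGen M a (w i) := by
    intro i
    induction i with
    | zero => intro _; rw [h0]
    | succ i ih => exact fun hi => (ih (by omega)).tail (hw i (by omega))
  have hto : ∀ j i, i + j = m → Relation.ReflTransGen M (w i) b := by
    intro j
    induction j with
    | zero => rintro i rfl; rw [← hm, Nat.add_zero]
    | succ j ih => exact fun i hi => (ih (i + 1) (by omega)).head (hw i (by omega))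
  refine ⟨w, h0, hm, fun i hi => ⟨?_, ha.2.1.trans (hfrom i hi), ?_⟩, hw⟩
  · rcases i with _ | i
    · rw [h0]; exact ha.1
    · exact hM _ _ (hw i (by omega))
  · exact (hto (m - i) i (by omega)).trans hb.2.2

theorem pathFlexible_sccOf [Finite L] {S : Set L} (hM : ∀ x y, M x y → y ∈ S) {a : L} {m : ℕ}
    (h : Steps M m a a) (h' : Steps M (m + 1) a a) : PathFlexible M (sccOf M S a) := by
  have hex : ∀ b : L, ∃ l l', b ∈ sccOf M S a → Steps M l a b ∧ Steps M l' b a := by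
    intro b
    by_cases hb : b ∈ sccOf M S a
    · obtain ⟨l, hl⟩ := exists_steps hb.2.1
      obtain ⟨l', hl'⟩ := exists_steps hb.2.2
      exact ⟨l, l', fun _ => ⟨hl, hl'⟩⟩
    · exact ⟨0, 0, fun h => absurd h hb⟩
  choose f g hfg using hex
  obtain ⟨B, hB⟩ := (Set.finite_range f).bddAbove
  obtain ⟨B', hB'⟩ := (Set.finite_range g).bddAbove
  -- `B'` and `B` bound the lengths of walks to and from `a`; what remains of `N` is at least `m *
  -- m` and is filled by a closed walk at `a`.
  refine ⟨B + B' + m * m + 1, Nat.succ_pos _, fun x hx y hy N hN => ?_⟩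
  have h1 : f y ≤ B := hB ⟨y, rfl⟩
  have h2 : g x ≤ B' := hB' ⟨x, rfl⟩
  have h3 := ((hfg x hx).2.trans (Steps.closed_of_le h h' (N := N - g x - f y) (by omega))).trans
    (hfg y hy).1
  rw [show g x + (N - g x - f y) + f y = N by omega] at h3
  exact h3.hasWalk hM hx hy

end Walks

/-! ### Unfolding a labeled tree: `trim` and the automaton. -/

namespace RootedTreeOn

variable {V : Type*} (G : RootedTreeOn V)

/-- All descendants at distance at most `d` lie in `M`, and those at distance less than `d` are not
leaves. -/
def Deep (M : V → Prop) : ℕ → V → Prop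
  | 0, v => M v
  | d + 1, v => M v ∧ (G.children v).Nonempty ∧ ∀ u ∈ G.children v, Deep M d u

variable {G} in
theorem Deep.mem {M : V → Prop} {d : ℕ} {v : V} (h : G.Deep M d v) : M v := by
  cases d with
  | zero => exact h
  | succ d => exact h.1

variable {G} in
theorem Deep.mono {M : V → Prop} {d d' : ℕ} (hd : d ≤ d') {v : V} (h : G.Deep M d' v) :
    G.Deep M d v := by
  induction d generalizing d' v with
  | zero => exact h.mem
  | succ d ih =>
    obtain ⟨d', rfl⟩ : ∃ e, d' = e + 1 := ⟨d' - 1, by omega⟩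
    exact ⟨h.1, h.2.1, fun u hu => ih (by omega) (h.2.2 u hu)⟩

theorem exists_enum_children [Finite V] {Δ : ℕ} (hG : G.IsRegular Δ) {v : V}
    (hv : (G.children v).Nonempty) :
    ∃ u : Fin Δ → V, Function.Injective u ∧ Set.range u = G.children v := by
  have hc : (G.children v).ncard = Δ :=
    (hG v).resolve_left (Set.ncard_ne_zero_of_mem hv.some_mem (Set.toFinite _))
  have e : G.children v ≃ Fin Δ := Finite.equivFinOfCardEq hc
  exact ⟨fun j => (e.symm j : V), Subtype.val_injective.comp e.symm.injective, by
    rw [show (fun j => (e.symm j : V)) = Subtype.val ∘ e.symm from rfl, Set.range_comp,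
      e.symm.surjective.range_eq, Set.image_univ, Subtype.range_coe]⟩

end RootedTreeOn

namespace RootedLCL

variable {Δ : ℕ} {L : Type*} (P : RootedLCL Δ L)

/-- The complete tree of depth `i` has a solution with labels in `S` and root label `a`. -/
def SolvableFrom (S : Set L) (i : ℕ) (a : L) : Prop :=
  ∃ ℓ : {w : List (Fin Δ) // w.length ≤ i} → L,
    P.IsSolution (completeTree Δ i) ℓ ∧ ℓ (completeTree Δ i).root = a ∧ ∀ w, ℓ w ∈ S

/-- Complete trees of one depth suffice to recognize `trim`. -/
theorem exists_trim_bound [Finite L] :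
    ∃ D, ∀ (S : Set L) (a : L), (∀ i ≤ D, P.SolvableFrom S i a) → a ∈ P.trim S := by
  have h : ∀ x : Set L × L, ∃ i, P.SolvableFrom x.1 i x.2 → x.2 ∈ P.trim x.1 := by
    rintro ⟨S, a⟩
    by_contra! hc
    -- The tree of depth `0` only serves to give `a ∈ S`, as `trim` speaks of positive depths.
    exact (hc 0).2 ⟨by obtain ⟨ℓ, -, h, h'⟩ := (hc 0).1; exact h ▸ h' _, fun i _ => (hc i).1⟩
  choose f hf using h
  obtain ⟨D, hD⟩ := (Set.finite_range f).bddAbove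
  exact ⟨D, fun S a ha => hf (S, a) (ha _ (hD ⟨(S, a), rfl⟩))⟩

-- The complete tree is mapped letter by letter to the first `i` layers below `v`, and the labels
-- are pulled back. `Deep` ensures that the children needed exist and that the labels met lie in
-- `S`.
variable {P} in
theorem IsSolution.solvableFrom (hΔ : 0 < Δ) {V : Type*} [Finite V] {G : RootedTreeOn V}
    (hG : G.IsRegular Δ) {ℓ : V → L} (hℓ : P.IsSolution G ℓ) {M : V → Prop} {S : Set L}
    (hM : ∀ v, M v → ℓ v ∈ S) {i : ℕ} {v : V} (hv : G.Deep M i v) : P.SolvableFrom S i (ℓ v) := by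
  have hch : ∀ v : V, ∃ u : Fin Δ → V, (G.children v).Nonempty →
      Function.Injective u ∧ Set.range u = G.children v := by
    intro v
    by_cases h : (G.children v).Nonempty
    · obtain ⟨u, hu⟩ := G.exists_enum_children hG h
      exact ⟨u, fun _ => hu⟩
    · exact ⟨fun _ => v, fun h' => absurd h' h⟩
  choose ch hch using hch
  let φ : List (Fin Δ) → V := fun w => w.rec v fun j _ x => ch x j
  have φcons : ∀ j w, φ (j :: w) = ch (φ w) j := fun _ _ => rfl
  have hdeep : ∀ w : List (Fin Δ), w.length ≤ i → G.Deep M (i - w.length) (φ w) := by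
    intro w
    induction w with
    | nil => exact fun _ => hv
    | cons j w ih =>
      intro hw
      rw [List.length_cons] at hw
      have h := ih (by omega)
      rw [show i - w.length = (i - (w.length + 1)) + 1 by omega] at h
      rw [List.length_cons]
      refine h.2.2 _ ?_
      rw [← (hch _ h.2.1).2, φcons]
      exact ⟨j, rfl⟩
  refine ⟨fun w => ℓ (φ w.1), ?_, rfl, fun w => hM _ (hdeep _ w.2).mem⟩
  rintro ⟨w, hw⟩ u hu hr
  have hcons : ∀ b, ∃ j, (u b).1 = j :: w := by
    intro b
    have hb : u b ∈ (completeTree Δ i).children ⟨w, hw⟩ := hr ▸ ⟨b, rfl⟩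
    obtain ⟨h1, h2⟩ := hb
    have h3 : (u b).1.tail = w := congrArg Subtype.val h2
    rcases hx : (u b).1 with _ | ⟨j, w'⟩
    · exact absurd (Subtype.ext hx) h1
    · rw [hx] at h3
      exact ⟨j, by rw [← h3]; rfl⟩
  choose c hc using hcons
  have hlt : w.length < i := by
    have := (u ⟨0, hΔ⟩).2
    rw [hc, List.length_cons] at this
    omega
  have hd := hdeep w hw
  rw [show i - w.length = (i - (w.length + 1)) + 1 by omega] at hd
  obtain ⟨hinj, hrange⟩ := hch _ hd.2.1
  refine hℓ (φ w) (fun b => φ (u b).1) ?_ ?_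
  · intro b b' hbb
    simp only [hc, φcons] at hbb
    have := hinj hbb
    exact hu (Subtype.ext (by rw [hc, hc, this]))
  · rw [← hrange]
    ext x
    constructor
    · rintro ⟨b, rfl⟩
      exact ⟨c b, by simp only [hc, φcons]⟩
    · rintro ⟨j, rfl⟩
      have : (⟨j :: w, hlt⟩ : {w : List (Fin Δ) // w.length ≤ i}) ∈
          (completeTree Δ i).children ⟨w, hw⟩ :=
        ⟨fun h => List.cons_ne_nil _ _ (congrArg Subtype.val h), rfl⟩
      rw [← hr] at this
      obtain ⟨b, hb⟩ := this
      exact ⟨b, by simp only [hb, φcons]⟩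

variable {P} in
/-- In a solution whose labels around a vertex lie in `S`, the label of a child is a successor of
the label of the vertex. -/
theorem IsSolution.automaton {V : Type*} [Finite V] {G : RootedTreeOn V}
    (hG : G.IsRegular Δ) {ℓ : V → L} (hℓ : P.IsSolution G ℓ) {S : Set L} {v u : V}
    (hv : ℓ v ∈ S) (hch : ∀ x ∈ G.children v, ℓ x ∈ S) (hu : u ∈ G.children v) :
    (P.restrict S).automaton (ℓ v) (ℓ u) := by
  obtain ⟨e, he, hr⟩ := G.exists_enum_children hG ⟨u, hu⟩
  have hmem : ∀ x : L, x ∈ multisetOf (ℓ ∘ e) ↔ ∃ j, ℓ (e j) = x := by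
    intro x
    rw [multisetOf, Sym.mem_mk]
    simp
  refine ⟨multisetOf (ℓ ∘ e), ⟨hℓ v e he hr, hv, fun x hx => ?_⟩, ?_⟩
  · obtain ⟨j, rfl⟩ := (hmem x).1 hx
    exact hch _ (hr ▸ ⟨j, rfl⟩)
  · rw [← hr] at hu
    obtain ⟨j, rfl⟩ := hu
    exact (hmem _).2 ⟨j, rfl⟩

theorem automaton_restrict_mem {S : Set L} {a b : L} (h : (P.restrict S).automaton a b) : b ∈ S := by
  obtain ⟨T, hT, hb⟩ := h
  exact hT.2.2 b hb

end RootedLCL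

/-! ### The kinds of vertices of the lower bound tree and their succession. -/

/-- The kinds of vertices of the hierarchical lower bound tree. A vertex `path b i r` lies on a path
of level `i` with `r` further vertices below it, where `b` tells whether the path is on the spine
of the tree; a vertex `tree i d` lies in a complete tree of level `i`, with `d` further layers below
it; `pad r` are the uppermost vertices of the spine. -/
inductive NodeKind
  | pad (r : ℕ)
  | path (b : Bool) (i r : ℕ)
  | tree (i d : ℕ)
  | leaf

namespace NodeKind

variable (k D s : ℕ)

/-- The kind of the main child (`true`) and of the other children (`false`). -/
def next : NodeKind → Bool → NodeKind
  | pad 0, true => path true 0 (2 * s)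
  | pad (r + 1), true => pad r
  | pad _, false => leaf
  | path b i (r + 1), true => path b i r
  | path false i 0, true => tree i D
  | path true i 0, true => if i + 1 < k then path true (i + 1) (2 * s) else tree (i + 1) D
  | path _ i _, false => tree i D
  | tree i (d + 1), _ => tree i d
  | tree 0 0, _ => leaf
  | tree (i + 1) 0, _ => path false i (2 * s)
  | leaf, _ => leaf

/-- The vertices of level at least `i`. -/
def AtLeast (i : ℕ) : NodeKind → Prop
  | pad _ => False
  | path _ l _ => i ≤ l
  | tree l _ => i < l
  | leaf => False

/-- The vertices between the spine center of level `i` and the other centers of level `i`. -/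
def Between (i : ℕ) : NodeKind → Prop
  | pad _ => False
  | path true l r => i < l ∨ i = l ∧ r ≤ s
  | path false l r => i < l ∨ i = l ∧ s ≤ r
  | tree l _ => i < l
  | leaf => False

/-- The vertices whose labels are controlled by the levels below `i`. -/
def Controlled : ℕ → NodeKind → Prop
  | 0, q => q ≠ leaf
  | i + 1, q => q.Between s i

/-- The vertices below a path of level `i`, without the path itself. -/
def Below (i : ℕ) : NodeKind → Prop
  | pad _ => False
  | path b l _ => b = false ∧ l < i
  | tree l _ => l ≤ i
  | leaf => True

variable {k D s}

theorem AtLeast.next {i : ℕ} {q : NodeKind} (h : q.AtLeast i) (b : Bool) :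
    (q.next k D s b).AtLeast i ∨ q.next k D s b = tree i D := by
  rcases q with r | ⟨c, l, r⟩ | ⟨l, d⟩ | _
  · exact h.elim
  · simp only [AtLeast] at h
    rcases r with _ | r <;> cases b <;> cases c <;> simp only [NodeKind.next]
    all_goals try split_ifs
    all_goals simp only [AtLeast, tree.injEq, reduceCtorEq, and_true, or_false]; omega
  · simp only [AtLeast] at h
    rcases d with _ | d
    · rcases l with _ | l
      · omega
      · left; simp only [NodeKind.next, AtLeast]; omega
    · left; simpa only [NodeKind.next, AtLeast]
  · exact h.elim

theorem AtLeast.mono {i j : ℕ} (hij : i ≤ j) {q : NodeKind} (h : q.AtLeast j) : q.AtLeast i := by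
  rcases q with r | ⟨c, l, r⟩ | ⟨l, d⟩ | _ <;> simp only [AtLeast] at h ⊢ <;> omega

theorem Between.atLeast {i : ℕ} {q : NodeKind} (h : q.Between s i) : q.AtLeast i := by
  rcases q with r | ⟨c, l, r⟩ | ⟨l, d⟩ | _ <;> try cases c
  all_goals simp only [Between, AtLeast] at h ⊢ <;> omega

theorem AtLeast.between {i j : ℕ} (hij : i < j) {q : NodeKind} (h : q.AtLeast j) :
    q.Between s i := by
  rcases q with r | ⟨c, l, r⟩ | ⟨l, d⟩ | _ <;> try cases c
  all_goals simp only [Between, AtLeast] at h ⊢ <;> omega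

theorem AtLeast.controlled {i : ℕ} {q : NodeKind} (h : q.AtLeast i) : q.Controlled s i := by
  rcases i with _ | i
  · rintro rfl
    exact h
  · exact h.between (Nat.lt_succ_self i)

theorem controlled_tree (i d : ℕ) : (tree i d).Controlled s i := by
  rcases i with _ | i
  · exact NodeKind.noConfusion
  · exact Nat.lt_succ_self i

theorem Between.next {i : ℕ} {q : NodeKind} (h : q.Between s i) (hq : q ≠ path false i s) :
    (q.next k D s true).Between s i := by
  rcases q with r | ⟨c, l, r⟩ | ⟨l, d⟩ | _
  · exact h.elim
  · rcases r with _ | r <;> cases c <;> simp only [NodeKind.next, Between, ne_eq, path.injEq,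
      true_and] at h hq ⊢
    all_goals first | omega | (split_ifs <;> omega)
  · simp only [Between] at h
    rcases d with _ | d
    · rcases l with _ | l
      · omega
      · simp only [NodeKind.next, Between]; omega
    · simpa only [NodeKind.next, Between]
  · exact h.elim

/-- The region is entered from above only at the spine center. Off the spine, paths of level `i`
hang below trees of level `i + 1`, which belong to the region. On the spine, paths start at `2 * s`,
which lies outside because `2 * s > s`. -/
theorem Between.of_next (hs : 0 < s) {i : ℕ} {q : NodeKind} {b : Bool}
    (h : (q.next k D s b).Between s i) (hq : q.next k D s b ≠ path true i s) : q.Between s i := by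
  rcases q with r | ⟨c, l, r⟩ | ⟨l, d⟩ | _
  · rcases r with _ | r <;> cases b <;> simp only [NodeKind.next, Between] at h
    omega
  · rcases r with _ | r <;> cases b <;> cases c <;> simp only [NodeKind.next, Between, ne_eq,
      path.injEq, true_and] at h hq ⊢
    all_goals first | omega | (split_ifs at h <;> omega)
  · rcases d with _ | d
    · rcases l with _ | l <;> simp only [NodeKind.next, Between] at h ⊢
      omega
    · simpa only [NodeKind.next, Between] using h
  · exact h.elim

/-- With `r < 2 * s` the vertex is not the top of its path, and all entrances to paths are at the
top. -/
theorem eq_of_next_eq_path {q : NodeKind} {b c : Bool} {i r : ℕ}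
    (h : q.next k D s b = path c i r) (hr : r < 2 * s) : q = path c i (r + 1) := by
  rcases q with r' | ⟨c', l, r'⟩ | ⟨l, d⟩ | _
  · rcases r' with _ | r' <;> cases b <;> simp only [NodeKind.next, path.injEq, reduceCtorEq] at h
    omega
  · rcases r' with _ | r' <;> cases b <;> cases c' <;> simp only [NodeKind.next, reduceCtorEq] at h
    · split_ifs at h
      simp only [path.injEq] at h
      omega
    · simp only [path.injEq] at h ⊢
      exact ⟨h.1, h.2.1, by omega⟩
    · simp only [path.injEq] at h ⊢
      exact ⟨h.1, h.2.1, by omega⟩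
  · rcases d with _ | d
    · rcases l with _ | l <;> simp only [NodeKind.next, path.injEq, reduceCtorEq] at h
      omega
    · simp only [NodeKind.next, reduceCtorEq] at h
  · simp only [NodeKind.next, reduceCtorEq] at h

theorem Below.next {i : ℕ} {q : NodeKind} (h : q.Below i) (b : Bool) :
    (q.next k D s b).Below i := by
  rcases q with r | ⟨c, l, r⟩ | ⟨l, d⟩ | _
  · exact h.elim
  · obtain ⟨rfl, h⟩ := h
    rcases r with _ | r <;> cases b <;> simp only [NodeKind.next, Below, true_and] <;> omega
  · simp only [Below] at h
    rcases d with _ | d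
    · rcases l with _ | l <;> simp only [NodeKind.next, Below, true_and]; omega
    · simpa only [NodeKind.next, Below]
  · trivial

theorem next_path (c b : Bool) (i r : ℕ) : (path c i (r + 1)).next k D s b = path c i r ∨
    ((path c i (r + 1)).next k D s b).Below i := by
  cases b
  · right
    cases c <;> exact le_rfl
  · left
    cases c <;> rfl

end NodeKind

/-! ### Scaffolds, and the local structure that survives rotations. -/

open NodeKind in
/-- `G` is the lower bound tree: `st` gives the kinds of the vertices, `main` the main child of
each vertex that is not a leaf, and `x₀ i` is the center of the spine path of level `i`. -/
structure IsScaffold {V : Type*} (Δ k D s : ℕ) (G : RootedTreeOn V) (st : V → NodeKind)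
    (main : V → V) (x₀ : ℕ → V) : Prop where
  isRegular : G.IsRegular Δ
  st_root : ∃ r, st G.root = pad r
  st_child : ∀ v, v ≠ G.root → ∃ b, st v = (st (G.parent v)).next k D s b
  main_mem : ∀ v, st v ≠ leaf → main v ∈ G.children v
  st_main : ∀ v, st v ≠ leaf → st (main v) = (st v).next k D s true
  st_center : ∀ i < k, ∀ x, st x = path true i s ↔ x = x₀ i

open NodeKind in
/-- The tree `H` has, for the levels below `m`, the same local structure as a lower bound tree, with
some relaxation at level `m`. -/
structure Compatible {V : Type*} (Δ k D s : ℕ) (st : V → NodeKind) (x₀ : ℕ → V)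
    (H : RootedTreeOn V) (m : ℕ) : Prop where
  isRegular : H.IsRegular Δ
  st_root : ∃ r, st H.root = pad r
  nonempty : ∀ v, st v ≠ leaf → (H.children v).Nonempty
  atLeast : ∀ i ≤ m, ∀ v, (st v).AtLeast i → ∀ u ∈ H.children v,
    (st u).AtLeast i ∨ st u = tree i D
  tree : ∀ i ≤ m, ∀ d v, st v = tree i (d + 1) → ∀ u ∈ H.children v, st u = tree i d
  up : ∀ i < m, i < k → ∀ v, (st v).Between s i → v ≠ x₀ i →
    v ≠ H.root ∧ (st (H.parent v)).Between s i
  down : ∀ i < m, ∀ v, (st v).Between s i → st v ≠ path false i s →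
    ∃ u ∈ H.children v, (st u).Between s i

section Scaffold

open NodeKind

variable {V : Type*} {Δ k D s : ℕ} {G : RootedTreeOn V} {st : V → NodeKind} {main : V → V}
  {x₀ : ℕ → V}

theorem IsScaffold.compatible (h : IsScaffold Δ k D s G st main x₀) (hs : 0 < s) (m : ℕ) :
    Compatible Δ k D s st x₀ G m where
  isRegular := h.isRegular
  st_root := h.st_root
  nonempty v hv := ⟨main v, h.main_mem v hv⟩
  atLeast i _ v hv u hu := by
    obtain ⟨b, hb⟩ := h.st_child u hu.1
    rw [hu.2] at hb
    rw [hb]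
    exact hv.next b
  tree i _ d v hv u hu := by
    obtain ⟨b, hb⟩ := h.st_child u hu.1
    rw [hu.2, hv] at hb
    rw [hb, next]
  up i _ hik v hv hx := by
    have hr : v ≠ G.root := by
      obtain ⟨r, hr⟩ := h.st_root
      rintro rfl
      rw [hr] at hv
      exact hv
    refine ⟨hr, ?_⟩
    obtain ⟨b, hb⟩ := h.st_child v hr
    rw [Ne, ← h.st_center i hik, hb] at hx
    rw [hb] at hv
    exact hv.of_next hs hx
  down i _ v hv hc := by
    have hl : st v ≠ leaf := by
      intro hl
      rw [hl] at hv
      exact hv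
    exact ⟨main v, h.main_mem v hl, by rw [h.st_main v hl]; exact hv.next hc⟩

theorem IsScaffold.main_iterate (h : IsScaffold Δ k D s G st main x₀) {x : V} {c : Bool} {i r : ℕ}
    (hx : st x = path c i r) {m : ℕ} (hm : m ≤ r) :
    st (main^[m] x) = path c i (r - m) ∧ G.parent^[m] (main^[m] x) = x := by
  induction m with
  | zero => exact ⟨hx, rfl⟩
  | succ m ih =>
    obtain ⟨h1, h2⟩ := ih (by omega)
    have hl : st (main^[m] x) ≠ leaf := by rw [h1]; exact NodeKind.noConfusion
    rw [Function.iterate_succ_apply' main, Function.iterate_succ_apply, h.st_main _ hl,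
      (h.main_mem _ hl).2, h1, show r - m = (r - (m + 1)) + 1 by omega]
    exact ⟨by cases c <;> rfl, h2⟩

theorem IsScaffold.parent_path (h : IsScaffold Δ k D s G st main x₀) {x : V} {c : Bool} {i r : ℕ}
    (hx : st x = path c i r) (hr : r < 2 * s) : st (G.parent x) = path c i (r + 1) := by
  have hroot : x ≠ G.root := by
    obtain ⟨r, hr⟩ := h.st_root
    rintro rfl
    rw [hr] at hx
    exact NodeKind.noConfusion hx
  obtain ⟨b, hb⟩ := h.st_child x hroot
  rw [hx] at hb
  exact eq_of_next_eq_path hb.symm hr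

theorem IsScaffold.parent_iterate (h : IsScaffold Δ k D s G st main x₀) {x : V} {c : Bool}
    {i r : ℕ} (hx : st x = path c i r) {m : ℕ} (hm : r + m ≤ 2 * s) :
    st (G.parent^[m] x) = path c i (r + m) := by
  induction m with
  | zero => exact hx
  | succ m ih =>
    rw [Function.iterate_succ_apply']
    have := h.parent_path (ih (by omega)) (show r + m < 2 * s by omega)
    exact this

theorem IsScaffold.main_last (h : IsScaffold Δ k D s G st main x₀) {x : V} {c : Bool} {i r : ℕ}
    (hx : st x = path c i r) : G.parent (main^[r + 1] x) = main^[r] x ∧ main^[r + 1] x ≠ G.root ∧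
      st (main^[r + 1] x) = (path c i 0).next k D s true := by
  obtain ⟨h1, -⟩ := h.main_iterate hx le_rfl
  have hl : st (main^[r] x) ≠ leaf := by rw [h1]; exact NodeKind.noConfusion
  rw [Function.iterate_succ_apply', h.st_main _ hl, h1, Nat.sub_self]
  exact ⟨(h.main_mem _ hl).2, (h.main_mem _ hl).1, rfl⟩

variable {H : RootedTreeOn V}

theorem RootedTreeOn.IsRotation.child_cases [DecidableEq V] {a p q : V}
    (h : G.IsRotation H a p q) {u v : V} (hu : u ∈ H.children v) :
    u ∈ G.children v ∨ (u = a ∧ v = G.parent q) ∨ (u = p ∧ v = G.parent a) ∨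
      (u = q ∧ v = G.parent p) := by
  rw [H.mem_children, h.root_eq] at hu
  by_cases h1 : u = a
  · subst h1; exact Or.inr (Or.inl ⟨rfl, by rw [← hu.2, h.parent_left]⟩)
  by_cases h2 : u = p
  · subst h2; exact Or.inr (Or.inr (Or.inl ⟨rfl, by rw [← hu.2, h.parent_mid]⟩))
  by_cases h3 : u = q
  · subst h3; exact Or.inr (Or.inr (Or.inr ⟨rfl, by rw [← hu.2, h.parent_right]⟩))
  exact Or.inl ⟨hu.1, by rw [← hu.2, h.parent_other h1 h2 h3]⟩

/-- A rotation at level `m` preserves the local structure of the lower levels. -/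
theorem Compatible.rotate [DecidableEq V] {m : ℕ} (hG : Compatible Δ k D s st x₀ G m) (hmk : m < k)
    (hx₀ : ∀ i < m, st (x₀ i) = path true i s) {a p q : V} (h : G.IsRotation H a p q)
    (ha : ∃ b r, st a = path b m r) (hp : ∃ b r, st p = path b m r)
    (hq : (st q).AtLeast m ∨ st q = NodeKind.tree m D) (hq' : ∃ b r, st (G.parent q) = path b m r) :
    Compatible Δ k D s st x₀ H m := by
  have La : (st a).AtLeast m := by obtain ⟨b, r, e⟩ := ha; rw [e]; exact le_rfl
  have Lp : (st p).AtLeast m := by obtain ⟨b, r, e⟩ := hp; rw [e]; exact le_rfl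
  have Lq : ∀ i < m, (st q).AtLeast i := by
    intro i hi
    rcases hq with hq | hq
    · exact hq.mono hi.le
    · rw [hq]; exact hi
  have Bq : ∀ i < m, (st q).Between s i := by
    intro i hi
    rcases hq with hq | hq
    · exact hq.between hi
    · rw [hq]; exact hi
  -- The cycle only permutes `a`, `p`, `q`, and these three belong to the region of every level
  -- below `m`. So the conditions `up` and `down` can be transported along the cycle.
  have Bc : ∀ i < m, ∀ v, (st (RootedTreeOn.cycle a p q v)).Between s i ↔ (st v).Between s i :=
    fun i hi v => h.cycle_mem (X := fun v => (st v).Between s i) (La.between hi) (Lp.between hi)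
      (Bq i hi) v
  refine ⟨h.isRegular hG.isRegular, by rw [h.root_eq]; exact hG.st_root, ?_, ?_, ?_, ?_, ?_⟩
  · intro v hv
    obtain ⟨u, hu⟩ := hG.nonempty v hv
    rw [h.children_eq]
    exact ⟨(RootedTreeOn.cycle a p q).symm u, by simpa using hu⟩
  · intro i hi v hv u hu
    rcases h.child_cases hu with hu | ⟨rfl, -⟩ | ⟨rfl, -⟩ | ⟨rfl, -⟩
    · exact hG.atLeast i hi v hv u hu
    · exact Or.inl (La.mono hi)
    · exact Or.inl (Lp.mono hi)
    · rcases hi.lt_or_eq with hi | rfl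
      · exact Or.inl (Lq i hi)
      · exact hq
  · intro i hi d v hv u hu
    -- A vertex with a child on a path of level `m` is not an inner layer of a tree of level `i ≤
    -- m`; hence the parents of `a` and `p` are no such vertices.
    have key : ∀ w, (∃ b r, st w = path b m r) → w ≠ G.root → v ≠ G.parent w := by
      rintro w ⟨b, r, e⟩ hw rfl
      have := hG.tree i hi d _ hv w ⟨hw, rfl⟩
      rw [e] at this
      exact NodeKind.noConfusion this
    rcases h.child_cases hu with hu | ⟨-, rfl⟩ | ⟨-, e⟩ | ⟨-, e⟩
    · exact hG.tree i hi d v hv u hu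
    · obtain ⟨b, r, e⟩ := hq'
      rw [e] at hv
      exact NodeKind.noConfusion hv
    · exact absurd e (key a ha h.ne_root)
    · exact absurd e (key p hp h.ne_root_mid)
  · intro i hi hik v hv hx
    have hne : ∀ w, (st w).AtLeast m ∨ st w = NodeKind.tree m D → x₀ i ≠ w := by
      rintro w hw rfl
      rw [hx₀ i hi] at hw
      rcases hw with hw | hw
      · exact absurd hi (not_lt.2 hw)
      · exact NodeKind.noConfusion hw
    have hcx : RootedTreeOn.cycle a p q (x₀ i) = x₀ i :=
      RootedTreeOn.cycle_other (hne a (Or.inl La)) (hne p (Or.inl Lp)) (hne q hq)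
    have := hG.up i hi hik (RootedTreeOn.cycle a p q v) ((Bc i hi v).2 hv)
      fun e => hx ((RootedTreeOn.cycle a p q).injective (e.trans hcx.symm))
    refine ⟨?_, by rw [h.parent_eq]; exact this.2⟩
    rw [h.root_eq]
    rintro rfl
    exact this.1 h.cycle_root
  · intro i hi v hv hc
    obtain ⟨u, hu, hb⟩ := hG.down i hi v hv hc
    refine ⟨(RootedTreeOn.cycle a p q).symm u, by rw [h.children_eq]; simpa using hu, ?_⟩
    rw [← Bc i hi]
    simpa using hb

end Scaffold

/-! ### From solutions on the rotated trees to a good sequence. -/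

section Levels

open NodeKind

variable {V : Type*} {Δ k D s : ℕ} {G H : RootedTreeOn V} {st : V → NodeKind} {main : V → V}
  {x₀ : ℕ → V} {m : ℕ} {L : Type*} {P : RootedLCL Δ L}

theorem Compatible.deep_tree (hH : Compatible Δ k D s st x₀ H m) {i : ℕ} (hi : i ≤ m) {d : ℕ}
    {v : V} (hv : st v = NodeKind.tree i d) : H.Deep (fun v => (st v).Controlled s i) d v := by
  induction d generalizing v with
  | zero =>
    change (st v).Controlled s i
    rw [hv]
    exact controlled_tree i 0
  | succ d ih =>
    refine ⟨show (st v).Controlled s i by rw [hv]; exact controlled_tree i _, hH.nonempty v (by rw [hv]; exact NodeKind.noConfusion), fun u hu => ?_⟩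
    exact ih (hH.tree i hi d v hv u hu)

/-- A descent stays at level at least `i` until it enters a tree of level `i` at its top, where `D`
further layers follow. So within `D` steps it meets only controlled vertices, and no leaf before the
last step. -/
theorem Compatible.deep (hH : Compatible Δ k D s st x₀ H m) {i : ℕ} (hi : i ≤ m)
    {v : V} (hv : (st v).AtLeast i ∨ st v = NodeKind.tree i D) :
    H.Deep (fun v => (st v).Controlled s i) D v := by
  suffices h : ∀ d ≤ D, ∀ v, (st v).AtLeast i ∨ st v = NodeKind.tree i D →
      H.Deep (fun v => (st v).Controlled s i) d v from h D le_rfl v hv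
  intro d
  induction d with
  | zero =>
    rintro - v (hv | hv)
    · exact hv.controlled
    · exact (hH.deep_tree hi hv).mono (Nat.zero_le D)
  | succ d ih =>
    rintro hd v (hv | hv)
    · refine ⟨hv.controlled, hH.nonempty v ?_, fun u hu => ih (by omega) u (hH.atLeast i hi v hv u hu)⟩
      intro hl
      rw [hl] at hv
      exact hv
    · exact (hH.deep_tree hi hv).mono hd

variable [Finite V] {ℓ : V → L} {S : Set L}

/-- Labels of controlled vertices in `S` force labels in `trim S` one level higher. -/
theorem Compatible.mem_trim (hH : Compatible Δ k D s st x₀ H m) (hΔ : 0 < Δ)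
    (hD : ∀ (S : Set L) (a : L), (∀ j ≤ D, P.SolvableFrom S j a) → a ∈ P.trim S)
    (hℓ : P.IsSolution H ℓ) {i : ℕ} (hi : i ≤ m) (hS : ∀ v, (st v).Controlled s i → ℓ v ∈ S)
    {v : V} (hv : (st v).AtLeast i ∨ st v = NodeKind.tree i D) : ℓ v ∈ P.trim S :=
  hD S _ fun _ hj => hℓ.solvableFrom hΔ hH.isRegular hS ((hH.deep hi hv).mono hj)

/-- The labels along a descending path of high level form a walk in the automaton. -/
theorem Compatible.steps (hH : Compatible Δ k D s st x₀ H m) (hΔ : 0 < Δ)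
    (hD : ∀ (S : Set L) (a : L), (∀ j ≤ D, P.SolvableFrom S j a) → a ∈ P.trim S)
    (hℓ : P.IsSolution H ℓ) {i : ℕ} (hi : i ≤ m) (hS : ∀ v, (st v).Controlled s i → ℓ v ∈ S)
    {u v : V} {r : ℕ} (huv : H.parent^[r] u = v)
    (hr : ∀ j ≤ r, (st (H.parent^[j] u)).AtLeast i) :
    Steps (P.restrict (P.trim S)).automaton r (ℓ v) (ℓ u) := by
  induction r generalizing v with
  | zero => exact congrArg ℓ huv.symm
  | succ r ih =>
    refine ⟨ℓ (H.parent^[r] u), ?_, ih rfl fun j hj => hr j (by omega)⟩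
    have h1 := hr r (by omega)
    have h2 := hr (r + 1) le_rfl
    rw [Function.iterate_succ_apply'] at huv h2
    rw [huv] at h2
    have hroot : H.parent^[r] u ≠ H.root := by
      obtain ⟨c, hc⟩ := hH.st_root
      intro e
      rw [e, hc] at h1
      exact h1
    exact hℓ.automaton hH.isRegular (hH.mem_trim hΔ hD hℓ hi hS (Or.inl h2))
      (fun x hx => hH.mem_trim hΔ hD hℓ hi hS (hH.atLeast i hi v h2 x hx)) ⟨hroot, huv⟩

/-- A solution on a tree compatible up to level `m` that gives the labels `ℓ₀` to the centers. -/
structure IsLevelSolution (k D s : ℕ) (st : V → NodeKind) (x₀ : ℕ → V) (P : RootedLCL Δ L)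
    (ℓ₀ : V → L) (m : ℕ) (H : RootedTreeOn V) (ℓ : V → L) : Prop where
  compatible : Compatible Δ k D s st x₀ H m
  isSolution : P.IsSolution H ℓ
  eq_of_center : ∀ j ≤ m, j < k → ∀ c y, st y = path c j s → ℓ y = ℓ₀ y

/-- The strongly connected components found by following the label `a i` on level `i`. -/
def components (P : RootedLCL Δ L) (a : ℕ → L) : ℕ → Set L
  | 0 => Set.univ
  | i + 1 => sccOf (P.restrict (P.trim (components P a i))).automaton (P.trim (components P a i)) (a i)

variable {ℓ₀ : V → L}

/-- From each center of level `i < k`, the spine center can be reached. -/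
def HasReturns (k D s : ℕ) (st : V → NodeKind) (x₀ : ℕ → V) (P : RootedLCL Δ L)
    (ℓ₀ : V → L) : Prop :=
  ∀ i < k, ∀ x, st x = path false i s → ∃ H ℓ, IsLevelSolution k D s st x₀ P ℓ₀ i H ℓ ∧
    H.parent^[2 * s + 1] (x₀ i) = x ∧
    ∀ j ≤ 2 * s + 1, (st (H.parent^[j] (x₀ i))).AtLeast i

/-- By induction on the level, labels at level at least `i` lie in `trim (C i)`. Climbing from `v`
to the spine center and descending from `v` to another center give walks to and from the label of
`v`. The return walk comes from a different tree, but starts and ends at the same labels because all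
these solutions agree on the centers of level `i`. -/
theorem label_mem_components (hΔ : 0 < Δ)
    (hD : ∀ (S : Set L) (a : L), (∀ j ≤ D, P.SolvableFrom S j a) → a ∈ P.trim S)
    (hx₀ : ∀ i < k, st (x₀ i) = path true i s) (hret : HasReturns k D s st x₀ P ℓ₀) {i : ℕ}
    (hik : i ≤ k) {m : ℕ} (him : i ≤ m) {H : RootedTreeOn V} {ℓ : V → L}
    (h : IsLevelSolution k D s st x₀ P ℓ₀ m H ℓ) {v : V} (hv : (st v).Controlled s i) :
    ℓ v ∈ components P (fun i => ℓ₀ (x₀ i)) i := by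
  induction i generalizing m H ℓ v with
  | zero => trivial
  | succ i ih =>
    have hS := fun {m : ℕ} (him : i ≤ m) {H : RootedTreeOn V} {ℓ : V → L}
      (h : IsLevelSolution k D s st x₀ P ℓ₀ m H ℓ) (v : V) (hv : (st v).Controlled s i) =>
      ih (by omega) him h hv
    replace hv : (st v).Between s i := hv
    have hi : i ≤ m := by omega
    have hC := h.compatible
    refine ⟨hC.mem_trim hΔ hD h.isSolution hi (hS hi h) (Or.inl hv.atLeast), ?_, ?_⟩
    · obtain ⟨r, hr, hb⟩ := H.exists_ancestor (M := fun v => (st v).Between s i) (x := x₀ i)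
        (hC.up i (by omega) (by omega)) hv
      have := (hC.steps hΔ hD h.isSolution hi (hS hi h) hr fun j hj => (hb j hj).atLeast).reflTransGen
      rwa [h.eq_of_center i hi (by omega) _ _ (hx₀ i (by omega))] at this
    · obtain ⟨x, r, hx, -, hr, hb⟩ := H.exists_descendant (M := fun v => (st v).Between s i)
        (E := fun v => st v = path false i s) (hC.down i (by omega)) hv
      have h1 := (hC.steps hΔ hD h.isSolution hi (hS hi h) hr fun j hj => (hb j hj).atLeast).reflTransGen
      rw [h.eq_of_center i hi (by omega) _ _ hx] at h1
      obtain ⟨H', ℓ', h', hp, hA⟩ := hret i (by omega) x hx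
      have h2 := (h'.compatible.steps hΔ hD h'.isSolution le_rfl (hS le_rfl h') hp hA).reflTransGen
      rw [h'.eq_of_center i le_rfl (by omega) _ _ hx,
        h'.eq_of_center i le_rfl (by omega) _ _ (hx₀ i (by omega))] at h2
      exact h1.trans h2

/-- A family of solutions on the lower bound tree and its rotations gives a long good sequence. -/
theorem exists_isGoodSequence [Finite L] (hΔ : 0 < Δ) (hs : 0 < s) (hk : 0 < k)
    (hD : ∀ (S : Set L) (a : L), (∀ j ≤ D, P.SolvableFrom S j a) → a ∈ P.trim S)
    (hG : IsScaffold Δ k D s G st main x₀) (hℓ₀ : P.IsSolution G ℓ₀)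
    (hret : HasReturns k D s st x₀ P ℓ₀)
    (hshift : ∀ i < k, ∃ H ℓ, IsLevelSolution k D s st x₀ P ℓ₀ i H ℓ ∧
      ∀ u r, G.parent^[r] u = main^[s + 1] (x₀ i) → (∀ j ≤ r, (st (G.parent^[j] u)).AtLeast i) →
        H.parent^[r + s] u = x₀ i ∧ ∀ j ≤ r + s, (st (H.parent^[j] u)).AtLeast i) :
    ∃ R C, P.IsGoodSequence (k + 1) R C := by
  have hx₀ : ∀ i < k, st (x₀ i) = path true i s := fun i hi => (hG.st_center i hi _).2 rfl
  have hsol : IsLevelSolution k D s st x₀ P ℓ₀ k G ℓ₀ :=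
    ⟨hG.compatible hs k, hℓ₀, fun _ _ _ _ _ _ => rfl⟩
  set C := components P (fun i => ℓ₀ (x₀ i)) with hC
  have hS := fun {i : ℕ} (hik : i ≤ k) {m : ℕ} (him : i ≤ m) {H : RootedTreeOn V} {ℓ : V → L}
      (h : IsLevelSolution k D s st x₀ P ℓ₀ m H ℓ) (v : V) (hv : (st v).Controlled s i) =>
      label_mem_components hΔ hD hx₀ hret hik him h hv
  have hcenter : ∀ i < k, ℓ₀ (x₀ i) ∈ P.trim (C i) := by
    intro i hi
    refine hsol.compatible.mem_trim hΔ hD hℓ₀ hi.le (hS hi.le hi.le hsol) (Or.inl ?_)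
    rw [hx₀ i hi]
    exact le_rfl
  refine ⟨fun i => P.trim (C (i - 1)), C, Nat.succ_pos k, rfl, fun i _ => rfl, ?_, ?_⟩
  · rintro (_ | i) h0 hi
    · omega
    have hi : i < k := by omega
    rw [Nat.add_sub_cancel]
    refine ⟨⟨ℓ₀ (x₀ i), hcenter i hi, rfl⟩, ?_⟩
    obtain ⟨hl1, hl2, hl3⟩ := hG.main_last (hx₀ i hi)
    obtain ⟨hm1, hm2⟩ := hG.main_iterate (hx₀ i hi) le_rfl
    have hup : G.parent^[s + 1] (main^[s + 1] (x₀ i)) = x₀ i := by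
      rw [Function.iterate_succ_apply, hl1, hm2]
    have hq : (st (main^[s + 1] (x₀ i))).Between s i := by
      rw [hl3]
      have : (path true i 0).Between s i := Or.inr ⟨rfl, Nat.zero_le s⟩
      exact this.next (by simp)
    obtain ⟨x, r, hx, -, hr, hb⟩ := G.exists_descendant (M := fun v => (st v).Between s i)
        (E := fun v => st v = path false i s) (hsol.compatible.down i hi) hq
    have hA : ∀ j ≤ r, (st (G.parent^[j] x)).AtLeast i := fun j hj => (hb j hj).atLeast
    obtain ⟨H, ℓ, h, hH⟩ := hshift i hi
    obtain ⟨hH1, hH2⟩ := hH x r hr hA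
    obtain ⟨H', ℓ', h', hp, hA'⟩ := hret i hi x hx
    have w1 := h.compatible.steps hΔ hD h.isSolution le_rfl (hS hi.le le_rfl h) hH1 hH2
    have w2 := h'.compatible.steps hΔ hD h'.isSolution le_rfl (hS hi.le le_rfl h') hp hA'
    have hr' : G.parent^[r + (s + 1)] x = x₀ i := by
      rw [Nat.add_comm, Function.iterate_add_apply, hr, hup]
    have w3 := hsol.compatible.steps hΔ hD hℓ₀ hi.le (hS hi.le hi.le hsol) hr' (by
      intro j hj
      rcases Nat.lt_or_ge r j with h1 | h1
      · obtain ⟨c, rfl⟩ : ∃ c, j = (c + 1) + r := ⟨j - r - 1, by omega⟩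
        rw [Function.iterate_add_apply, hr, Function.iterate_succ_apply, hl1,
          hG.parent_iterate (hm1.trans (by rw [Nat.sub_self])) (by omega)]
        exact le_rfl
      · exact hA j h1)
    rw [h.eq_of_center i le_rfl hi _ _ hx, h.eq_of_center i le_rfl hi _ _ (hx₀ i hi)] at w1
    rw [h'.eq_of_center i le_rfl hi _ _ hx, h'.eq_of_center i le_rfl hi _ _ (hx₀ i hi)] at w2
    -- Closed walks of lengths `r + 3 * s + 1` and `r + 3 * s + 2`: down to `x` in the shifted tree
    -- or in `G`, then back in the tree rotated at `x`.
    refine pathFlexible_sccOf (fun x y h => P.automaton_restrict_mem h) (w1.trans w2) ?_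
    have := w3.trans w2
    rwa [show r + (s + 1) + (2 * s + 1) = r + s + (2 * s + 1) + 1 by omega] at this
  · rintro (_ | i) h0 hi
    · omega
    rw [Nat.add_sub_cancel]
    rcases (show i ≤ k by omega).lt_or_eq with hi | rfl
    · exact ⟨_, hcenter i hi⟩
    -- The last set of the sequence contains the label at the top of the tree of level `k` in which
    -- the spine ends.
    · obtain ⟨j, rfl⟩ : ∃ j, i = j + 1 := ⟨i - 1, by omega⟩
      obtain ⟨-, -, hl3⟩ := hG.main_last (hx₀ j (Nat.lt_succ_self j))
      refine ⟨_, hsol.compatible.mem_trim hΔ hD hℓ₀ le_rfl (hS le_rfl le_rfl hsol)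
        (v := main^[s + 1] (x₀ j)) (Or.inr ?_)⟩
      rw [hl3, next, if_neg (lt_irrefl _)]

end Levels

/-! ### The rotations of a level: invisibility and effect on paths. -/

section LevelRotations

open NodeKind

variable {V : Type*} {Δ k D s : ℕ} {G H : RootedTreeOn V} {st : V → NodeKind} {main : V → V}
  {x₀ : ℕ → V}

theorem RootedTreeOn.child_mem_ball {y a : V} {t : ℕ} (h : G.parent a ∈ G.ball y t) :
    a ∈ G.ball y (t + 1) := by
  rw [G.mem_ball_succ]
  by_cases ha : G.parent a = a
  · left
    rwa [ha] at h
  · exact Or.inr ⟨_, h, G.adj_iff.2 ⟨ha, Or.inr rfl⟩⟩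

theorem IsScaffold.st_descendant (h : IsScaffold Δ k D s G st main x₀) {w u : V} {c : Bool}
    {j r b : ℕ} (hw : st w = path c j r) (hb : b ≤ r) (hu : G.parent^[b] u = w) :
    st u = path c j (r - b) ∨ (st u).Below j := by
  induction b generalizing u with
  | zero =>
    exact Or.inl ((congrArg st hu).trans hw)
  | succ b ih =>
    have hr : u ≠ G.root := by
      obtain ⟨e, he⟩ := h.st_root
      rintro rfl
      rw [G.iterate_root] at hu
      rw [← hu, he] at hw
      exact NodeKind.noConfusion hw
    obtain ⟨b', hb'⟩ := h.st_child u hr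
    rw [hb']
    rcases ih (by omega) hu with h1 | h1
    · rw [h1, show r - b = (r - (b + 1)) + 1 by omega]
      exact next_path c b' j _
    · exact Or.inr (h1.next b')

/-- The surroundings of a center of level `j`. -/
theorem IsScaffold.st_of_mem_ball (h : IsScaffold Δ k D s G st main x₀) {y u : V} {c : Bool}
    {j t : ℕ} (hy : st y = path c j s) (ht : t < s) (hu : u ∈ G.ball y t) :
    (∃ r, st u = path c j r ∧ 0 < r ∧ r < 2 * s) ∨ (st u).Below j := by
  -- The common ancestor is fewer than `s` steps above the center, so it is on the same path, below
  -- its top. The descent from there to `u` is too short to pass the bottom of the path.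
  obtain ⟨i, i', hi, e⟩ := G.exists_common_ancestor hu
  have h1 := h.parent_iterate hy (m := i) (by omega)
  rcases h.st_descendant h1 (by omega) e.symm with h2 | h2
  · exact Or.inl ⟨_, h2, by omega, by omega⟩
  · exact Or.inr h2

variable [DecidableEq V]

/-- `H` is a rotation of level `i` at the center `x`: the part of the spine around the spine
center is exchanged with the path of `x`, or, if `x` is the spine center itself, with the last vertex
of its path. -/
def IsLevelRotation (s : ℕ) (G : RootedTreeOn V) (st : V → NodeKind) (main : V → V) (x₀ : ℕ → V)
    (i : ℕ) (x : V) (H : RootedTreeOn V) : Prop :=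
  ∃ p, G.IsRotation H (G.parent^[s] (x₀ i)) p (main^[s + 1] x) ∧
    ((st x = path false i s ∧ p = G.parent^[s] x) ∨ (x = x₀ i ∧ p = main^[s] x))

theorem IsScaffold.exists_isLevelRotation (h : IsScaffold Δ k D s G st main x₀) (hs : 0 < s) {i : ℕ}
    (hi : i < k) {x : V} (hx : st x = path false i s ∨ x = x₀ i) :
    ∃ H, IsLevelRotation s G st main x₀ i x H := by
  have hx₀ := (h.st_center i hi _).2 rfl
  have ha : G.parent^[s] (x₀ i) ≠ G.root := by
    obtain ⟨e, he⟩ := h.st_root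
    have := h.parent_iterate hx₀ (m := s) (by omega)
    intro h'
    rw [h', he] at this
    exact NodeKind.noConfusion this
  rcases hx with hx | rfl
  · have hp := h.parent_iterate hx (m := s) (by omega)
    have hb : (st (G.parent^[s] x)).Between s i := by
      rw [hp]
      exact Or.inr ⟨rfl, Nat.le_add_right s s⟩
    -- The top `p` of the path of `x` lies in the region below the spine center, so it is a
    -- descendant of `a`, the top of the spine path.
    obtain ⟨m, hm, -⟩ := G.exists_ancestor (M := fun v => (st v).Between s i) (x := x₀ i)
      ((h.compatible hs k).up i hi hi) hb
    obtain ⟨H, hH⟩ := G.exists_isRotation (p := G.parent^[s] x) (q := main^[s + 1] x) ha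
      ⟨s + m, by omega, by rw [Function.iterate_add_apply, hm]⟩
      ⟨s + (s + 1), by omega, by
        rw [Function.iterate_add_apply, Function.iterate_succ_apply, (h.main_last hx).1,
          (h.main_iterate hx le_rfl).2]⟩
    exact ⟨H, _, hH, Or.inl ⟨hx, rfl⟩⟩
  · obtain ⟨H, hH⟩ := G.exists_isRotation (p := main^[s] (x₀ i)) (q := main^[s + 1] (x₀ i)) ha
      ⟨s + s, by omega, by rw [Function.iterate_add_apply, (h.main_iterate hx₀ le_rfl).2]⟩
      ⟨1, one_pos, (h.main_last hx₀).1⟩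
    exact ⟨H, _, hH, Or.inr ⟨rfl, rfl⟩⟩

variable {i : ℕ} {x : V}

theorem IsLevelRotation.compatible (hH : IsLevelRotation s G st main x₀ i x H)
    (h : IsScaffold Δ k D s G st main x₀) (hs : 0 < s) (hi : i < k) :
    Compatible Δ k D s st x₀ H i := by
  obtain ⟨p, hp, hx⟩ := hH
  have hx₀ : ∀ j ≤ i, st (x₀ j) = path true j s := fun j hj => (h.st_center j (by omega) _).2 rfl
  have hx' : ∃ c, st x = path c i s := by
    rcases hx with ⟨hx, -⟩ | ⟨rfl, -⟩
    · exact ⟨_, hx⟩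
    · exact ⟨_, hx₀ i le_rfl⟩
  obtain ⟨c, hc⟩ := hx'
  obtain ⟨h1, h2, h3⟩ := h.main_last hc
  have h4 := (h.main_iterate hc le_rfl).1
  refine (h.compatible hs i).rotate hi (fun j hj => hx₀ j hj.le) hp
    ⟨_, _, h.parent_iterate (hx₀ i le_rfl) (m := s) (by omega)⟩ ?_ ?_ ⟨_, _, by rw [h1]; exact h4⟩
  · rcases hx with ⟨hx, rfl⟩ | ⟨rfl, rfl⟩
    · exact ⟨_, _, h.parent_iterate hx (by omega)⟩
    · exact ⟨_, _, h4⟩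
  · rw [h3]
    exact AtLeast.next (q := path c i 0) (le_refl i) true

/-- A rotation of level `i` is invisible from the centers of level at most `i`. -/
theorem IsLevelRotation.congr (hH : IsLevelRotation s G st main x₀ i x H)
    (h : IsScaffold Δ k D s G st main x₀) (hi : i < k) {t : ℕ} (ht : t + 2 < s)
    {c : Bool} {j : ℕ} (hj : j ≤ i) {y : V} (hy : st y = path c j s) :
    H.ball y t = G.ball y t ∧ ∀ z ∈ G.ball y t, H.children z = G.children z := by
  obtain ⟨p, hp, hx⟩ := hH
  have hx₀ := (h.st_center i hi _).2 rfl
  have hx' : ∃ c, st x = path c i s := by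
    rcases hx with ⟨hx, -⟩ | ⟨rfl, -⟩
    · exact ⟨_, hx⟩
    · exact ⟨_, hx₀⟩
  obtain ⟨c', hc'⟩ := hx'
  have hbelow : ∀ b r, ¬ (path b i r).Below j := fun b r hb => absurd hb.2 (by omega)
  have ha : G.parent^[s] (x₀ i) ∉ G.ball y (t + 1) := by
    intro hm
    have h1 := h.parent_iterate hx₀ (m := s) (by omega)
    rcases h.st_of_mem_ball hy (by omega) hm with ⟨r, h2, -, h3⟩ | h2
    · rw [h1, path.injEq] at h2
      omega
    · rw [h1] at h2
      exact hbelow _ _ h2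
  have hpb : p ∉ G.ball y (t + 1) := by
    intro hm
    have h1 : ∃ b r, st p = path b i r ∧ (r = 0 ∨ r = 2 * s) := by
      rcases hx with ⟨hx, rfl⟩ | ⟨rfl, rfl⟩
      · exact ⟨_, _, h.parent_iterate hx (m := s) (by omega), by omega⟩
      · exact ⟨_, _, (h.main_iterate hx₀ le_rfl).1, by omega⟩
    obtain ⟨b, r', h1, h1'⟩ := h1
    rcases h.st_of_mem_ball hy (by omega) hm with ⟨r, h2, h3, h4⟩ | h2
    · rw [h1, path.injEq] at h2
      omega
    · rw [h1] at h2
      exact hbelow _ _ h2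
  -- The cut point `q` is just outside the path, so its parent, the bottom vertex, is considered
  -- instead. This needs radius `t + 2`, whence the hypothesis `t + 2 < s`.
  have hqb : main^[s + 1] x ∉ G.ball y (t + 1) := by
    intro hm
    have hm := G.parent_mem_ball hm
    rw [(h.main_last hc').1] at hm
    have h1 := (h.main_iterate hc' le_rfl).1
    rcases h.st_of_mem_ball hy (by omega) hm with ⟨r, h2, h3, h4⟩ | h2
    · rw [h1, path.injEq] at h2
      omega
    · rw [h1] at h2
      exact hbelow _ _ h2
  have hne : ∀ z ∈ G.ball y t, ∀ w ∉ G.ball y (t + 1), z ≠ w ∧ z ≠ G.parent w := by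
    intro z hz w hw
    constructor
    · rintro rfl
      exact hw (G.ball_mono (Nat.le_succ t) hz)
    · rintro rfl
      exact hw (RootedTreeOn.child_mem_ball hz)
  refine ⟨G.ball_congr fun z hz u => ?_, fun z hz => ?_⟩
  · exact hp.adj_iff (hne z hz _ ha).1 (hne z hz _ hpb).1 (hne z hz _ hqb).1 (hne z hz _ ha).2
      (hne z hz _ hpb).2 (hne z hz _ hqb).2 u
  · exact hp.children_congr (hne z hz _ ha).2 (hne z hz _ hpb).2 (hne z hz _ hqb).2

/-- After the rotation at a center `x`, the spine center lies below `x`. -/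
theorem IsLevelRotation.return_path (hH : IsLevelRotation s G st main x₀ i x H)
    (h : IsScaffold Δ k D s G st main x₀) (hs : 0 < s) (hi : i < k) (hx : st x = path false i s) :
    H.parent^[2 * s + 1] (x₀ i) = x ∧
      ∀ j ≤ 2 * s + 1, (st (H.parent^[j] (x₀ i))).AtLeast i := by
  obtain ⟨p, hp, hx'⟩ := hH
  have hx₀ := (h.st_center i hi _).2 rfl
  obtain rfl : p = G.parent^[s] x := by
    rcases hx' with ⟨-, rfl⟩ | ⟨rfl, -⟩
    · rfl
    · rw [hx₀] at hx
      simp at hx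
  have hsa := h.parent_iterate hx₀ (m := s) (by omega)
  have hsp := h.parent_iterate hx (m := s) (by omega)
  obtain ⟨hl1, -, hsq⟩ := h.main_last hx
  have hsq' : st (main^[s + 1] x) = tree i D := hsq
  obtain ⟨hm1, hm2⟩ := h.main_iterate hx le_rfl
  rw [Nat.sub_self] at hm1
  have hne : ∀ v c r, st v = path c i r → r < 2 * s → v ≠ G.parent^[s] (x₀ i) ∧
      v ≠ G.parent^[s] x ∧ v ≠ main^[s + 1] x := by
    intro v c r hv hr
    refine ⟨?_, ?_, ?_⟩ <;> rintro rfl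
    · rw [hsa, path.injEq] at hv; omega
    · rw [hsp, path.injEq] at hv; omega
    · rw [hsq'] at hv; exact NodeKind.noConfusion hv
  have e1 : ∀ j ≤ s, H.parent^[j] (x₀ i) = G.parent^[j] (x₀ i) := fun j hj =>
    hp.iterate_other fun j' hj' => hne _ _ _ (h.parent_iterate hx₀ (m := j') (by omega)) (by omega)
  have e2 : ∀ j ≤ s, H.parent^[j] (main^[s] x) = G.parent^[j] (main^[s] x) := fun j hj =>
    hp.iterate_other fun j' hj' => hne _ _ _ (h.parent_iterate hm1 (m := j') (by omega)) (by omega)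
  -- After `s` steps from the spine center to the top `a` of its path, one more step leads to the
  -- bottom of the path of `x`; another `s` steps lead to `x`.
  have e3 : ∀ j ≤ s, H.parent^[j + (s + 1)] (x₀ i) = G.parent^[j] (main^[s] x) := by
    intro j hj
    rw [Function.iterate_add_apply, Function.iterate_succ_apply', e1 s le_rfl, hp.parent_left, hl1,
      e2 j hj]
  refine ⟨by rw [show 2 * s + 1 = s + (s + 1) by omega, e3 s le_rfl, hm2], fun j hj => ?_⟩
  rcases Nat.lt_or_ge s j with h1 | h1
  · obtain ⟨c, rfl⟩ : ∃ c, j = c + (s + 1) := ⟨j - (s + 1), by omega⟩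
    rw [e3 c (by omega), h.parent_iterate hm1 (by omega)]
    exact le_rfl
  · rw [e1 j h1, h.parent_iterate hx₀ (by omega)]
    exact le_rfl

/-- The rotation at the spine center shortens the paths below it by one. -/
theorem IsLevelRotation.shift (hH : IsLevelRotation s G st main x₀ i (x₀ i) H)
    (h : IsScaffold Δ k D s G st main x₀) (hs : 0 < s) (hi : i < k) {u : V} {r : ℕ}
    (hu : G.parent^[r] u = main^[s + 1] (x₀ i))
    (hr : ∀ j ≤ r, (st (G.parent^[j] u)).AtLeast i) :
    H.parent^[r + s] u = x₀ i ∧ ∀ j ≤ r + s, (st (H.parent^[j] u)).AtLeast i := by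
  obtain ⟨p, hp, hx'⟩ := hH
  have hx₀ := (h.st_center i hi _).2 rfl
  obtain rfl : p = main^[s] (x₀ i) := by
    rcases hx' with ⟨hx, -⟩ | ⟨-, rfl⟩
    · rw [hx₀] at hx
      simp at hx
    · rfl
  have hsa := h.parent_iterate hx₀ (m := s) (by omega)
  obtain ⟨hl1, hl2, -⟩ := h.main_last hx₀
  obtain ⟨hm1, hm2⟩ := h.main_iterate hx₀ le_rfl
  rw [Nat.sub_self] at hm1
  have hd1 := hp.depth_lt_left
  have hd2 := hp.depth_lt_right
  have e1 : ∀ j ≤ r, H.parent^[j] u = G.parent^[j] u := by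
    refine fun j hj => hp.iterate_other fun j' hj' => ?_
    have : G.parent^[r - j'] (G.parent^[j'] u) = main^[s + 1] (x₀ i) := by
      rw [← Function.iterate_add_apply, show r - j' + j' = r by omega, hu]
    have := G.depth_iterate this hl2
    refine ⟨?_, ?_, ?_⟩ <;> intro e <;> rw [e] at this <;> omega
  obtain ⟨c, rfl⟩ : ∃ c, s = c + 1 := ⟨s - 1, by omega⟩
  have hw : st (G.parent (main^[c + 1] (x₀ i))) = path true i 1 := h.parent_path hm1 (by omega)
  have hdp := G.depth_parent hp.ne_root_mid
  have e2 : ∀ j ≤ c, H.parent^[j] (G.parent (main^[c + 1] (x₀ i))) =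
      G.parent^[j] (G.parent (main^[c + 1] (x₀ i))) := by
    refine fun j hj => hp.iterate_other fun j' hj' => ?_
    have hst := h.parent_iterate hw (m := j') (by omega)
    refine ⟨?_, ?_, ?_⟩ <;> intro e
    · rw [e, hsa, path.injEq] at hst; omega
    · rw [e, hm1, path.injEq] at hst; omega
    · have := G.depth_iterate e hl2
      omega
  -- The bottom vertex `p` of the spine path has been moved above `a`; the climb from `q` skips it
  -- and reaches the spine center in `s` instead of `s + 1` steps.
  have e3 : ∀ j ≤ c, H.parent^[j + (r + 1)] u = G.parent^[j] (G.parent (main^[c + 1] (x₀ i))) := by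
    intro j hj
    rw [Function.iterate_add_apply, Function.iterate_succ_apply', e1 r le_rfl, hu, hp.parent_right,
      e2 j hj]
  refine ⟨?_, fun j hj => ?_⟩
  · rw [show r + (c + 1) = c + (r + 1) by omega, e3 c le_rfl, ← Function.iterate_succ_apply, hm2]
  · rcases Nat.lt_or_ge r j with h1 | h1
    · obtain ⟨d, rfl⟩ : ∃ d, j = d + (r + 1) := ⟨j - (r + 1), by omega⟩
      rw [e3 d (by omega), h.parent_iterate hw (by omega)]
      exact le_rfl
    · rw [e1 j h1]
      exact hr j h1

end LevelRotations

/-! ### Trees generated by a state machine, and their sizes. -/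

section Words

variable {Δ : ℕ} {Q : Type*} (step : Q → Fin Δ → Q) (IsLeaf : Q → Prop)

/-- The words along which one can descend from the root of a tree whose vertices carry states. -/
def ValidWord : Q → List (Fin Δ) → Prop
  | _, [] => True
  | q, j :: w => ¬ IsLeaf q ∧ ValidWord (step q j) w

variable {step IsLeaf}

theorem validWord_append {q : Q} {w : List (Fin Δ)} {j : Fin Δ} :
    ValidWord step IsLeaf q (w ++ [j]) ↔ ValidWord step IsLeaf q w ∧ ¬ IsLeaf (w.foldl step q) := by
  induction w generalizing q with
  | nil => simp [ValidWord]
  | cons i w ih => simp [ValidWord, ih, and_assoc]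

theorem ValidWord.dropLast {q : Q} {w : List (Fin Δ)} (h : ValidWord step IsLeaf q w) :
    ValidWord step IsLeaf q w.dropLast := by
  rcases List.eq_nil_or_concat' w with rfl | ⟨w, j, rfl⟩
  · exact h
  · rw [List.dropLast_concat]
    exact (validWord_append.1 h).1

variable (step IsLeaf) in
/-- The tree of the valid words, in which the last letter leads from the parent to the child. -/
def wordTree (q : Q) : RootedTreeOn {w : List (Fin Δ) // ValidWord step IsLeaf q w} where
  root := ⟨[], trivial⟩
  parent w := ⟨w.1.dropLast, w.2.dropLast⟩
  parent_root := rfl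
  reaches_root := by
    rintro ⟨w, hw⟩
    induction w using List.reverseRecOn with
    | nil => exact ⟨0, rfl⟩
    | append_singleton w j ih =>
      obtain ⟨m, hm⟩ := ih (validWord_append.1 hw).1
      refine ⟨m + 1, ?_⟩
      rw [Function.iterate_succ_apply, ← hm]
      congr 1
      exact Subtype.ext List.dropLast_concat

theorem mem_children_wordTree {q : Q} {u v : {w : List (Fin Δ) // ValidWord step IsLeaf q w}} :
    u ∈ (wordTree step IsLeaf q).children v ↔ ∃ j, u.1 = v.1 ++ [j] := by
  constructor
  · rintro ⟨h1, h2⟩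
    have h2 : u.1.dropLast = v.1 := congrArg Subtype.val h2
    rcases List.eq_nil_or_concat' u.1 with h | ⟨w, j, h⟩
    · exact absurd (Subtype.ext h) h1
    · rw [h, List.dropLast_concat] at h2
      exact ⟨j, by rw [h, h2]⟩
  · rintro ⟨j, hj⟩
    refine ⟨fun h => ?_, Subtype.ext ?_⟩
    · rw [h] at hj
      simp [wordTree] at hj
    · change u.1.dropLast = v.1
      rw [hj, List.dropLast_concat]

theorem isRegular_wordTree (q : Q) : (wordTree step IsLeaf q).IsRegular Δ := by
  intro v
  by_cases hl : IsLeaf (v.1.foldl step q)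
  · left
    have : (wordTree step IsLeaf q).children v = ∅ := by
      ext u
      rw [mem_children_wordTree]
      constructor
      · rintro ⟨j, hj⟩
        have := u.2
        rw [hj, validWord_append] at this
        exact this.2 hl
      · exact fun h => h.elim
    rw [this, Set.ncard_empty]
  · right
    let f : Fin Δ → {w : List (Fin Δ) // ValidWord step IsLeaf q w} := fun j =>
      ⟨v.1 ++ [j], validWord_append.2 ⟨v.2, hl⟩⟩
    have hf : Function.Injective f := by
      intro j j' h
      have h' : v.1 ++ [j] = v.1 ++ [j'] := congrArg Subtype.val h
      simpa using h'
    have : (wordTree step IsLeaf q).children v = Set.range f := by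
      ext u
      rw [mem_children_wordTree]
      exact ⟨fun ⟨j, hj⟩ => ⟨j, Subtype.ext hj.symm⟩, fun ⟨j, hj⟩ => ⟨j, hj ▸ rfl⟩⟩
    rw [this, ← Set.image_univ, Set.ncard_image_of_injective _ hf, Set.ncard_univ]
    simp

/-- A valid word is empty or consists of a letter and a valid word for the child. -/
def validWordEquiv {q : Q} (hq : ¬ IsLeaf q) : {w // ValidWord step IsLeaf q w} ≃
    Option (Σ j, {w // ValidWord step IsLeaf (step q j) w}) where
  toFun := fun
    | ⟨[], _⟩ => none
    | ⟨j :: w, h⟩ => some ⟨j, w, h.2⟩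
  invFun := fun
    | none => ⟨[], trivial⟩
    | some ⟨j, w⟩ => ⟨j :: w.1, hq, w.2⟩
  left_inv := by rintro ⟨_ | ⟨j, w⟩, h⟩ <;> rfl
  right_inv := by rintro (_ | ⟨j, w⟩) <;> rfl

theorem card_validWord_leaf {q : Q} (hq : IsLeaf q) :
    Nat.card {w // ValidWord step IsLeaf q w} = 1 := by
  rw [Nat.card_eq_one_iff_unique]
  refine ⟨⟨?_⟩, ⟨[], trivial⟩⟩
  rintro ⟨_ | ⟨j, w⟩, h⟩ ⟨_ | ⟨j', w'⟩, h'⟩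
  · rfl
  · exact absurd hq h'.1
  · exact absurd hq h.1
  · exact absurd hq h.1

theorem card_validWord {q : Q} (hq : ¬ IsLeaf q)
    (h : ∀ j, Finite {w // ValidWord step IsLeaf (step q j) w}) :
    Nat.card {w // ValidWord step IsLeaf q w} =
      (∑ j, Nat.card {w // ValidWord step IsLeaf (step q j) w}) + 1 := by
  rw [Nat.card_congr (validWordEquiv hq), Finite.card_option, Nat.card_sigma]

/-- A bound on the number of vertices that is compatible with the branching. -/
theorem finite_validWord {U : Q → ℕ} (h1 : ∀ q, 1 ≤ U q)
    (hU : ∀ q, ¬ IsLeaf q → (∑ j, U (step q j)) + 1 ≤ U q) (q : Q) :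
    Finite {w // ValidWord step IsLeaf q w} ∧ Nat.card {w // ValidWord step IsLeaf q w} ≤ U q ∧
      Nat.card {w // ValidWord step IsLeaf q w} ≡ 1 [MOD Δ] := by
  induction hm : U q using Nat.strong_induction_on generalizing q with
  | _ m ih =>
    by_cases hq : IsLeaf q
    · have := card_validWord_leaf (step := step) hq
      refine ⟨Nat.finite_of_card_ne_zero (by omega), by rw [this, ← hm]; exact h1 q, by rw [this]⟩
    · have hlt : ∀ j, U (step q j) < m := by
        intro j
        have h2 := Finset.single_le_sum (fun j _ => Nat.zero_le (U (step q j))) (Finset.mem_univ j)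
        have h3 := hU q hq
        omega
      have hfin := fun j => (ih _ (hlt j) _ rfl).1
      rw [card_validWord hq hfin]
      refine ⟨Finite.of_equiv _ (validWordEquiv hq).symm, ?_, ?_⟩
      · have h3 := hU q hq
        have h4 : ∑ j, Nat.card {w // ValidWord step IsLeaf (step q j) w} ≤ ∑ j, U (step q j) :=
          Finset.sum_le_sum fun j _ => (ih _ (hlt j) _ rfl).2.1
        omega
      -- The `Δ` subtrees, each of size `1` modulo `Δ`, add up to `0`, and the vertex itself adds
      -- `1`.
      · have h4 : ∑ j, Nat.card {w // ValidWord step IsLeaf (step q j) w} ≡ ∑ _j : Fin Δ, 1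
            [MOD Δ] := Nat.ModEq.sum fun j _ => (ih _ (hlt j) _ rfl).2.2
        have h5 : ∑ _j : Fin Δ, 1 ≡ 0 [MOD Δ] := by simp [Nat.ModEq]
        exact (h4.trans h5).add_right 1

end Words

/-- The tree `G` with the vertices renamed by `e`. -/
def RootedTreeOn.map {V W : Type*} (G : RootedTreeOn V) (e : V ≃ W) : RootedTreeOn W where
  root := e G.root
  parent w := e (G.parent (e.symm w))
  parent_root := by simp [G.parent_root]
  reaches_root w := by
    obtain ⟨m, hm⟩ := G.reaches_root (e.symm w)
    refine ⟨m, ?_⟩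
    have h : Function.Semiconj e G.parent fun w => e (G.parent (e.symm w)) := fun v => by simp
    have := h.iterate_right m (e.symm w)
    rw [hm] at this
    rw [this, e.apply_symm_apply]

theorem RootedTreeOn.children_map {V W : Type*} (G : RootedTreeOn V) (e : V ≃ W) (w : W) :
    (G.map e).children w = e '' G.children (e.symm w) := by
  ext u
  rw [e.image_eq_preimage_symm, Set.mem_preimage]
  change u ≠ e G.root ∧ e (G.parent (e.symm u)) = w ↔ e.symm u ≠ G.root ∧ G.parent (e.symm u) = _
  rw [Ne, Ne, e.symm_apply_eq, Equiv.eq_symm_apply]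

theorem IsScaffold.map {V W : Type*} {Δ k D s : ℕ} {G : RootedTreeOn V} {st : V → NodeKind}
    {main : V → V} {x₀ : ℕ → V} (h : IsScaffold Δ k D s G st main x₀) (e : V ≃ W) :
    IsScaffold Δ k D s (G.map e) (fun w => st (e.symm w)) (fun w => e (main (e.symm w)))
      (fun i => e (x₀ i)) where
  isRegular w := by
    rw [G.children_map, Set.ncard_image_of_injective _ e.injective]
    exact h.isRegular _
  st_root := by
    obtain ⟨r, hr⟩ := h.st_root
    exact ⟨r, by simpa [RootedTreeOn.map] using hr⟩
  st_child v hv := by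
    obtain ⟨b, hb⟩ := h.st_child (e.symm v) fun h' => hv ((e.symm_apply_eq).1 h')
    exact ⟨b, by simpa [RootedTreeOn.map] using hb⟩
  main_mem v hv := by
    rw [G.children_map]
    exact ⟨_, h.main_mem _ hv, rfl⟩
  st_main v hv := by simpa using h.st_main _ hv
  st_center i hi x := by rw [h.st_center i hi, e.symm_apply_eq]

/-! ### Construction of the lower bound tree with exactly `n` vertices. -/

section Construction

open NodeKind

/-- The kind of the `j`-th child. -/
def NodeKind.step (k D s : ℕ) {Δ : ℕ} (q : NodeKind) (j : Fin Δ) : NodeKind :=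
  q.next k D s (decide (j.1 = 0))

/-- A bound on the number of vertices below a vertex, in trees with `δ + 1` children, where `Z`
bounds the growth from level to level. -/
def NodeKind.weight (k D s δ Z : ℕ) : NodeKind → ℕ
  | leaf => 1
  | tree i d => (δ + 2) ^ (d + 1) * Z ^ i
  | path false i r => (r + 1) * ((δ + 2) ^ (D + 2) * Z ^ i)
  | path true i r => (r + 1) * ((δ + 2) ^ (D + 2) * Z ^ i) + (k - 1 - i) * Z ^ k +
      (δ + 2) ^ (D + 1) * Z ^ (max k (i + 1))
  | pad r => (r + 1) * (δ + 1) + ((2 * s + 1) * ((δ + 2) ^ (D + 2) * Z ^ 0) + (k - 1 - 0) * Z ^ k +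
      (δ + 2) ^ (D + 1) * Z ^ (max k (0 + 1)))

variable {k D s δ Z : ℕ}

theorem NodeKind.one_le_weight (hZ : 0 < Z) (q : NodeKind) : 1 ≤ q.weight k D s δ Z := by
  rcases q with r | ⟨_ | _, i, r⟩ | ⟨i, d⟩ | _ <;> simp only [weight] <;>
    apply Nat.succ_le_of_lt <;> positivity

/-- By the choice of `Z`, a path of level `i` off the spine has weight `Z ^ (i + 1)`, the unit of
the trees of level `i + 1`. A path vertex has a budget of `δ + 2` trees for its `δ` side trees; the
surplus pays for the vertex itself and for the tree at the end of the path. A spine path also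
reserves `Z ^ k` for each later spine path, and the final tree. The maximum with `k` in `weight`
covers spine kinds of level at least `k`, which do not occur but must satisfy the inequality. -/
theorem NodeKind.weight_next (hZ : (2 * s + 1) * (δ + 2) ^ (D + 2) = Z) {q : NodeKind}
    (hq : q ≠ leaf) :
    (q.next k D s true).weight k D s δ Z + δ * (q.next k D s false).weight k D s δ Z + 1 ≤
      q.weight k D s δ Z := by
  have hZ0 : 0 < Z := by rw [← hZ]; positivity
  have hdef : ∀ i, (2 * s + 1) * ((δ + 2) ^ (D + 2) * Z ^ i) = Z ^ (i + 1) := fun i => by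
    rw [← mul_assoc, hZ, pow_succ']
  rcases q with r | ⟨b, i, r⟩ | ⟨i, d⟩ | _
  · rcases r with _ | r
    · simp only [next, weight]
      omega
    · simp only [next, weight]
      rw [Nat.succ_mul (r + 1)]
      omega
  · have hX : 0 < (δ + 2) ^ (D + 1) * Z ^ i := by positivity
    have hX' : (δ + 2) ^ (D + 2) * Z ^ i =
        δ * ((δ + 2) ^ (D + 1) * Z ^ i) + 2 * ((δ + 2) ^ (D + 1) * Z ^ i) := by
      rw [← add_mul, ← mul_assoc, ← pow_succ']
    have hside : ((path b i r).next k D s false).weight k D s δ Z = (δ + 2) ^ (D + 1) * Z ^ i := by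
      rcases r with _ | r <;> cases b <;> simp only [next, weight]
    rw [hside]
    rcases r with _ | r
    · cases b
      · simp only [next, weight, zero_add, one_mul]
        omega
      · simp only [next]
        split_ifs with hik
        · simp only [weight, hdef, zero_add, one_mul]
          have h1 : max k (i + 1) = k := by omega
          have h2 : max k (i + 1 + 1) = k := by omega
          have h3 : k - 1 - i = (k - 1 - (i + 1)) + 1 := by omega
          have h4 : Z ^ (i + 1 + 1) ≤ Z ^ k := Nat.pow_le_pow_right hZ0 (by omega)
          rw [h1, h2, h3, Nat.succ_mul]
          omega
        · simp only [weight, zero_add, one_mul]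
          have h1 : max k (i + 1) = i + 1 := by omega
          rw [h1]
          omega
    · have h2 := Nat.succ_mul (r + 1) ((δ + 2) ^ (D + 2) * Z ^ i)
      rw [Nat.succ_eq_add_one] at h2
      cases b <;> simp only [next, weight] <;> omega
  · have key : ∀ Y, 0 < Y → Y + δ * Y + 1 ≤ (δ + 2) * Y := by
      intro Y hY
      rw [add_mul]
      omega
    rcases d with _ | d
    · rcases i with _ | i
      · simp only [next, weight, pow_zero, zero_add, pow_one]
        omega
      · simp only [next, weight, zero_add, pow_one, hdef]
        exact key _ (by positivity)
    · simp only [next, weight]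
      rw [pow_succ' (δ + 2) (d + 1), mul_assoc]
      exact key _ (by positivity)
  · exact absurd rfl hq

theorem sum_step {f : NodeKind → ℕ} (q : NodeKind) :
    ∑ j : Fin (δ + 1), f (q.step k D s j) = f (q.next k D s true) + δ * f (q.next k D s false) := by
  rw [Fin.sum_univ_succ]
  simp [NodeKind.step]

/-- The position on the spine of the vertices of a given kind. -/
def NodeKind.spineIndex (s R : ℕ) : NodeKind → ℕ
  | pad r => R - r
  | path true i r => R + 1 + i * (2 * s + 1) + (2 * s - r)
  | _ => 0

/-- The kinds of vertices that occur on the spine. -/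
def NodeKind.OnSpine (s R : ℕ) : NodeKind → Prop
  | pad r => r ≤ R
  | path true _ r => r ≤ 2 * s
  | _ => False

theorem NodeKind.spine_next {R : ℕ} {q : NodeKind} {b : Bool}
    (h : (∃ r, q.next k D s b = pad r) ∨ ∃ i r, q.next k D s b = path true i r) :
    b = true ∧ ((∃ r, q = pad r) ∨ ∃ i r, q = path true i r) ∧
      (q.OnSpine s R → (q.next k D s b).OnSpine s R ∧
        (q.next k D s b).spineIndex s R = q.spineIndex s R + 1) := by
  rcases q with r | ⟨c, i, r⟩ | ⟨i, d⟩ | _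
  · rcases r with _ | r <;> cases b <;> simp only [next, OnSpine, spineIndex] at h ⊢ <;> simp at h ⊢
    omega
  · rcases r with _ | r <;> cases b <;> cases c <;> simp only [next, OnSpine, spineIndex] at h ⊢ <;>
      (try simp at h ⊢)
    · split_ifs with hi
      · refine ⟨le_rfl, ?_⟩
        ring_nf
        omega
      · simp [hi] at h
    · omega
  · rcases d with _ | d
    · rcases i with _ | i <;> simp [next] at h
    · simp [next] at h
  · simp [next] at h

/-- Spine kinds arise only by main steps from spine kinds, and each such step raises the index by
one. So the kind determines the vertex; in particular the spine center of each level is unique. -/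
theorem eq_replicate_of_spine {R : ℕ} (w : List (Fin (δ + 1)))
    (h : (∃ r, w.foldl (NodeKind.step k D s) (pad R) = pad r) ∨
      ∃ i r, w.foldl (NodeKind.step k D s) (pad R) = path true i r) :
    (w.foldl (NodeKind.step k D s) (pad R)).OnSpine s R ∧
      w = List.replicate ((w.foldl (NodeKind.step k D s) (pad R)).spineIndex s R) 0 := by
  induction w using List.reverseRecOn with
  | nil => simp [OnSpine, spineIndex]
  | append_singleton w j ih =>
    rw [List.foldl_append, List.foldl_cons, List.foldl_nil] at h ⊢
    obtain ⟨h1, h2, h3⟩ := NodeKind.spine_next (R := R) h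
    obtain ⟨h4, h5⟩ := ih h2
    obtain ⟨h6, h7⟩ := h3 h4
    refine ⟨h6, ?_⟩
    change _ = List.replicate (((w.foldl (NodeKind.step k D s) (pad R)).next k D s _).spineIndex s R) 0
    rw [h7, List.replicate_succ', ← h5]
    have : j = 0 := Fin.ext (by simpa using h1)
    rw [this]

/-- Lower bound trees of all admissible sizes exist. -/
theorem exists_isScaffold {Δ : ℕ} (hΔ : 0 < Δ) {k : ℕ} (hk : 0 < k) (D s : ℕ) {n : ℕ}
    (hn : n ≡ 1 [MOD Δ])
    (hsize : (k + (Δ + 1) ^ (D + 1)) * ((2 * s + 1) * (Δ + 1) ^ (D + 2)) ^ k + Δ ≤ n) :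
    ∃ (G : RootedTreeOn (Fin n)) (st : Fin n → NodeKind) (main : Fin n → Fin n) (x₀ : ℕ → Fin n),
      IsScaffold Δ k D s G st main x₀ := by
  classical
  obtain ⟨δ, rfl⟩ : ∃ δ, Δ = δ + 1 := ⟨Δ - 1, by omega⟩
  rw [show δ + 1 + 1 = δ + 2 from rfl] at hsize
  have hZ : 0 < (2 * s + 1) * (δ + 2) ^ (D + 2) := by positivity
  have hfin := finite_validWord (step := NodeKind.step k D s (Δ := δ + 1)) (IsLeaf := (· = leaf))
    (U := NodeKind.weight k D s δ _) (NodeKind.one_le_weight hZ) fun q hq => by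
      rw [sum_step]
      exact NodeKind.weight_next rfl hq
  set N : NodeKind → ℕ := fun q =>
    Nat.card {w // ValidWord (NodeKind.step k D s (Δ := δ + 1)) (· = leaf) q w} with hN
  have hrec : ∀ q, q ≠ leaf → N q = N (q.next k D s true) + δ * N (q.next k D s false) + 1 := by
    intro q hq
    simp only [hN]
    rw [card_validWord (IsLeaf := (· = leaf)) hq fun j => (hfin _).1]
    rw [sum_step (f := N)]
  have hleaf : N leaf = 1 := card_validWord_leaf rfl
  have hpad : ∀ r, N (pad r) = (δ + 1) * (r + 1) + N (path true 0 (2 * s)) := by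
    intro r
    induction r with
    | zero =>
      rw [hrec _ (by simp), next, next, hleaf]
      ring
    | succ r ih =>
      rw [hrec _ (by simp), next, next, hleaf, ih]
      ring
  have hcore : N (path true 0 (2 * s)) + (δ + 1) ≤ n := by
    have h1 := (hfin (path true 0 (2 * s))).2.1
    have h2 : (2 * s + 1) * (δ + 2) ^ (D + 2) ≤ ((2 * s + 1) * (δ + 2) ^ (D + 2)) ^ k :=
      Nat.le_self_pow hk.ne' _
    simp only [weight, pow_zero, mul_one, Nat.sub_zero, Nat.zero_add, max_eq_left (show 1 ≤ k from hk)]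
      at h1
    rw [add_mul] at hsize
    have h3 : k * ((2 * s + 1) * (δ + 2) ^ (D + 2)) ^ k =
        (k - 1) * ((2 * s + 1) * (δ + 2) ^ (D + 2)) ^ k + ((2 * s + 1) * (δ + 2) ^ (D + 2)) ^ k := by
      rw [← Nat.succ_mul, show (k - 1).succ = k by omega]
    simp only [hN]
    omega
  -- Each pad vertex adds itself and `δ` leaves, so pads realize all sizes in the residue class. At
  -- least one pad is present and keeps the root away from the cut points.
  obtain ⟨R, hR⟩ : ∃ R, N (pad R) = n := by
    have h1 : N (path true 0 (2 * s)) ≡ n [MOD δ + 1] := (hfin _).2.2.trans hn.symm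
    obtain ⟨c, hc⟩ := (Nat.modEq_iff_dvd' (by omega)).1 h1
    rcases c with _ | c
    · rw [Nat.mul_zero] at hc
      omega
    · exact ⟨c, by rw [hpad]; omega⟩
  have := (hfin (pad R)).1
  set W := {w // ValidWord (NodeKind.step k D s (Δ := δ + 1)) (· = leaf) (pad R) w} with hW
  let e : W ≃ Fin n := Finite.equivFinOfCardEq hR
  let G := wordTree (NodeKind.step k D s (Δ := δ + 1)) (· = leaf) (pad R)
  let st : W → NodeKind := fun w => w.1.foldl (NodeKind.step k D s) (pad R)
  let main : W → W := fun w => if h : st w = leaf then w else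
    ⟨w.1 ++ [0], validWord_append.2 ⟨w.2, h⟩⟩
  have hmain : ∀ w, st w ≠ leaf → (main w).1 = w.1 ++ [0] := fun w hw => by
    simp only [main, dif_neg hw]
  have hst : ∀ w, st w ≠ leaf → st (main w) = (st w).next k D s true := by
    intro w hw
    change (main w).1.foldl _ _ = _
    rw [hmain w hw, List.foldl_append]
    rfl
  have hexpad : ∀ c ≤ R, ∃ w, st w = pad (R - c) := by
    intro c
    induction c with
    | zero => exact fun _ => ⟨⟨[], trivial⟩, rfl⟩
    | succ c ih =>
      intro hc
      obtain ⟨w, hw⟩ := ih (by omega)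
      refine ⟨main w, ?_⟩
      rw [hst w (by simp [hw]), hw, show R - c = (R - (c + 1)) + 1 by omega]
      rfl
  have hdown : ∀ i, (∃ w, st w = path true i (2 * s)) →
      ∀ c ≤ 2 * s, ∃ w, st w = path true i (2 * s - c) := by
    intro i hi c
    induction c with
    | zero => exact fun _ => hi
    | succ c ih =>
      intro hc
      obtain ⟨w, hw⟩ := ih (by omega)
      refine ⟨main w, ?_⟩
      rw [hst w (by simp [hw]), hw, show 2 * s - c = (2 * s - (c + 1)) + 1 by omega]
      rfl
  have hexpath : ∀ i < k, ∃ w, st w = path true i (2 * s) := by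
    intro i
    induction i with
    | zero =>
      intro _
      obtain ⟨w, hw⟩ := hexpad R le_rfl
      refine ⟨main w, ?_⟩
      rw [hst w (by simp [hw]), hw, Nat.sub_self]
      rfl
    | succ i ih =>
      intro hi
      obtain ⟨w, hw⟩ := hdown i (ih (by omega)) (2 * s) le_rfl
      refine ⟨main w, ?_⟩
      rw [hst w (by simp [hw]), hw, Nat.sub_self, next, if_pos hi]
  have hcenter : ∀ i, ∃ w, i < k → st w = path true i s := by
    intro i
    by_cases hi : i < k
    · obtain ⟨w, hw⟩ := hdown i (hexpath i hi) s (by omega)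
      exact ⟨w, fun _ => by rw [hw]; congr 1; omega⟩
    · exact ⟨⟨[], trivial⟩, fun h => absurd h hi⟩
  choose x₀ hx₀ using hcenter
  have hscaffold : IsScaffold (δ + 1) k D s G st main x₀ := by
    refine ⟨isRegular_wordTree _, ⟨R, rfl⟩, fun v hv => ?_, fun v hv => ?_, hst, fun i hi x => ?_⟩
    · have hv' : v ∈ G.children (G.parent v) := ⟨hv, rfl⟩
      obtain ⟨j, hj⟩ := mem_children_wordTree.1 hv'
      refine ⟨decide (j.1 = 0), ?_⟩
      change v.1.foldl _ _ = _
      rw [hj, List.foldl_append]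
      rfl
    · exact mem_children_wordTree.2 ⟨0, hmain v hv⟩
    · refine ⟨fun h => ?_, fun h => h ▸ hx₀ i hi⟩
      have h1 := (eq_replicate_of_spine x.1 (Or.inr ⟨_, _, h⟩)).2
      have h2 := (eq_replicate_of_spine (x₀ i).1 (Or.inr ⟨_, _, hx₀ i hi⟩)).2
      apply Subtype.ext
      rw [h1, h2]
      change List.replicate ((st x).spineIndex s R) 0 = List.replicate ((st (x₀ i)).spineIndex s R) 0
      rw [h, hx₀ i hi]
  exact ⟨_, _, _, _, hscaffold.map e⟩

end Construction

/-! ### The union bound. -/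

section Probability

instance : IsProbabilityMeasure randomBits := by
  unfold randomBits
  infer_instance

/-- If among `n` events of probability at most `1 / n` two agree, then some point lies outside all of
them. -/
theorem exists_forall_notMem {Ω : Type*} [MeasurableSpace Ω] {μ : Measure Ω}
    [IsProbabilityMeasure μ] {n : ℕ} {B : Fin n → Set Ω} (hB : ∀ v, μ (B v) ≤ 1 / (n : ENNReal))
    {u v : Fin n} (huv : u ≠ v) (h : B u = B v) : ∃ ω, ∀ w, ω ∉ B w := by
  by_contra! hc
  -- `B u` may be dropped in favor of `B v`; the remaining `n - 1` events have total probability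
  -- below `1`.
  have hcover : Set.univ ⊆ ⋃ w ∈ Finset.univ.erase u, B w := by
    intro ω _
    obtain ⟨w, hw⟩ := hc ω
    simp only [Set.mem_iUnion]
    by_cases hwu : w = u
    · exact ⟨v, Finset.mem_erase.2 ⟨huv.symm, Finset.mem_univ v⟩, by rw [← h, ← hwu]; exact hw⟩
    · exact ⟨w, Finset.mem_erase.2 ⟨hwu, Finset.mem_univ w⟩, hw⟩
  have hn : 0 < n := u.pos
  have h1 : (1 : ENNReal) ≤ ((n - 1 : ℕ) : ENNReal) / n := by
    calc (1 : ENNReal) = μ Set.univ := measure_univ.symm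
      _ ≤ μ (⋃ w ∈ Finset.univ.erase u, B w) := measure_mono hcover
      _ ≤ ∑ w ∈ Finset.univ.erase u, μ (B w) := measure_biUnion_finset_le _ _
      _ ≤ ∑ _w ∈ Finset.univ.erase u, 1 / (n : ENNReal) := Finset.sum_le_sum fun w _ => hB w
      _ = ((n - 1 : ℕ) : ENNReal) / n := by
        rw [Finset.sum_const, Finset.card_erase_of_mem (Finset.mem_univ u), Finset.card_univ,
          Fintype.card_fin, nsmul_eq_mul, mul_one_div]
  rw [ENNReal.le_div_iff_mul_le (Or.inl (by exact_mod_cast hn.ne')) (Or.inl (by simp)), one_mul,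
    Nat.cast_le] at h1
  omega

end Probability

/-! ### The order of the adversary, and the algorithm on all rotations at once. -/

section Simulation

open NodeKind

theorem RootedTreeOn.view_congr {n : ℕ} {G H : RootedTreeOn (Fin n)} {t : ℕ}
    {σ : Equiv.Perm (Fin n)} {i : Fin n}
    (h : ∀ j ≤ i, H.ball (σ j) t = G.ball (σ j) t ∧
      ∀ z ∈ G.ball (σ j) t, H.children z = G.children z) : H.view t σ i = G.view t σ i := by
  have hseen : ∀ u, (∃ j ≤ i, u ∈ H.ball (σ j) t) ↔ ∃ j ≤ i, u ∈ G.ball (σ j) t := fun u =>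
    exists_congr fun j => and_congr_right fun hj => by rw [(h j hj).1]
  refine View.ext rfl (Set.ext hseen) ?_
  funext u v
  refine propext ?_
  change (_ ∧ _ ∧ _) ↔ (_ ∧ _ ∧ _)
  rw [hseen, hseen]
  refine and_congr_right fun _ => and_congr_right fun ⟨j, hj, hv⟩ => ?_
  rw [(h j hj).2 v hv]

/-- The level at which a vertex is revealed. -/
def NodeKind.rank (k s : ℕ) : NodeKind → ℕ
  | path _ i r => if r = s then min i k else k
  | _ => k

theorem NodeKind.exists_eq_of_rank_lt {k s : ℕ} {q : NodeKind} (h : q.rank k s < k) :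
    ∃ c, q = path c (q.rank k s) s := by
  rcases q with r | ⟨c, i, r⟩ | ⟨i, d⟩ | _ <;> simp only [rank, lt_irrefl] at h ⊢
  by_cases hr : r = s
  · rw [if_pos hr] at h ⊢
    exact ⟨c, by rw [hr, min_eq_left (by omega)]⟩
  · rw [if_neg hr] at h
    omega

theorem NodeKind.rank_path {k s : ℕ} (c : Bool) {i : ℕ} (hi : i < k) :
    (path c i s).rank k s = i := by
  simp only [rank, if_true]
  omega

/-- An algorithm of small locality that succeeds on all trees of a given size yields a long good
sequence. -/
theorem exists_isGoodSequence_of_algorithm {Δ k D n : ℕ} {L : Type*} [Finite L]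
    {P : RootedLCL Δ L} (hΔ : 0 < Δ) (hk : 0 < k)
    (hD : ∀ (S : Set L) (a : L), (∀ j ≤ D, P.SolvableFrom S j a) → a ∈ P.trim S)
    (A : RandOnlineLocalAlgorithm L) (hn : n ≡ 1 [MOD Δ])
    (hsize : (k + (Δ + 1) ^ (D + 1)) *
      ((2 * (A.locality n + 3) + 1) * (Δ + 1) ^ (D + 2)) ^ k + Δ ≤ n)
    (hA : ∀ G : RootedTreeOn (Fin n), G.IsRegular Δ → ∀ σ : Equiv.Perm (Fin n),
      randomBits {ω | ¬ P.IsSolution G (A.run G σ ω)} ≤ 1 / (n : ENNReal)) :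
    ∃ R C, P.IsGoodSequence (k + 1) R C := by
  classical
  obtain ⟨G, st, main, x₀, hG⟩ := exists_isScaffold hΔ hk D (A.locality n + 3) hn hsize
  set s := A.locality n + 3 with hs
  have hs0 : 0 < s := by omega
  have hx₀ : ∀ i < k, st (x₀ i) = path true i s := fun i hi => (hG.st_center i hi _).2 rfl
  -- Centers come first, by increasing level. The order depends only on the kinds in `G`, so it is
  -- the same for all rotations.
  let σ := Tuple.sort fun v => (st v).rank k s
  have hσ : Monotone fun i => (st (σ i)).rank k s := Tuple.monotone_sort fun v => (st v).rank k s
  -- The trees are indexed by the vertices: a center of level below `k` is assigned its rotation, a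
  -- vertex that is not a center the tree `G` itself.
  have hF : ∀ x, ∃ H : RootedTreeOn (Fin n), H.IsRegular Δ ∧
      (∀ i < k, (st x = path false i s ∨ x = x₀ i) → IsLevelRotation s G st main x₀ i x H) ∧
      ((¬ ∃ c i, st x = path c i s) → H = G) := by
    intro x
    by_cases hx : ∃ i < k, st x = path false i s ∨ x = x₀ i
    · obtain ⟨i, hi, hx⟩ := hx
      obtain ⟨H, hH⟩ := hG.exists_isLevelRotation hs0 hi hx
      have hst : ∀ j < k, (st x = path false j s ∨ x = x₀ j) → ∃ c, st x = path c j s := by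
        rintro j hj (h | rfl)
        · exact ⟨_, h⟩
        · exact ⟨_, hx₀ j hj⟩
      obtain ⟨c, hc⟩ := hst i hi hx
      refine ⟨H, (hH.compatible hG hs0 hi).isRegular, fun j hj hx' => ?_, fun h => absurd ⟨_, _, hc⟩ h⟩
      obtain ⟨c', hc'⟩ := hst j hj hx'
      rw [hc, path.injEq] at hc'
      obtain rfl := hc'.2.1
      exact hH
    · exact ⟨G, hG.isRegular, fun i hi h => absurd ⟨i, hi, h⟩ hx, fun _ => rfl⟩
  choose F hFreg hFrot hFG using hF
  obtain ⟨r, hr⟩ := hG.st_root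
  have hroot : F G.root = G := hFG _ (by simp [hr])
  -- The index set has `n` elements, for which the plain union bound only gives `1`; a second index
  -- with tree `G`, besides the root, makes it strict.
  have hbase : ∃ v, v ≠ G.root ∧ F v = G := by
    refine ⟨G.parent^[s] (x₀ 0), ?_, hFG _ ?_⟩
    · have := hG.parent_iterate (hx₀ 0 hk) (m := s) (by omega)
      intro h
      rw [h, hr] at this
      exact NodeKind.noConfusion this
    · rintro ⟨c, i, h⟩
      rw [hG.parent_iterate (hx₀ 0 hk) (by omega), path.injEq] at h
      omega
  obtain ⟨v₀, hv₀, hv₀G⟩ := hbase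
  obtain ⟨ω, hω⟩ := exists_forall_notMem (μ := randomBits)
    (B := fun v => {ω | ¬ P.IsSolution (F v) (A.run (F v) σ ω)})
    (fun v => hA (F v) (hFreg v) σ) hv₀ (by simp only [hroot, hv₀G])
  have hsol : ∀ v, P.IsSolution (F v) (A.run (F v) σ ω) := fun v => not_not.1 (hω v)
  have hlevel : ∀ i < k, ∀ x, (st x = path false i s ∨ x = x₀ i) →
      IsLevelSolution k D s st x₀ P (A.run G σ ω) i (F x) (A.run (F x) σ ω) := by
    intro i hi x hx
    have hrot := hFrot x i hi hx
    refine ⟨hrot.compatible hG hs0 hi, hsol x, fun j hj hjk c y hy => ?_⟩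
    unfold RandOnlineLocalAlgorithm.run
    rw [RootedTreeOn.view_congr fun l hl => ?_]
    -- All vertices revealed no later than `y` are centers of level at most `j ≤ i`, to which the
    -- rotation is invisible; so the views coincide.
    have h1 : (st (σ l)).rank k s ≤ j := by
      have := hσ hl
      simp only [Equiv.apply_symm_apply, hy, rank_path c hjk] at this
      exact this
    obtain ⟨c', hc'⟩ := exists_eq_of_rank_lt (h1.trans_lt hjk)
    exact hrot.congr hG hi (by omega) (h1.trans hj) hc'
  refine exists_isGoodSequence (ℓ₀ := A.run G σ ω) hΔ hs0 hk hD hG ?_ ?_ ?_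
  · have := hsol G.root
    rwa [hroot] at this
  · intro i hi x hx
    have hrot := hFrot x i hi (Or.inl hx)
    exact ⟨_, _, hlevel i hi x (Or.inl hx), hrot.return_path hG hs0 hi hx⟩
  · intro i hi
    have hrot := hFrot (x₀ i) i hi (Or.inr rfl)
    exact ⟨_, _, hlevel i hi _ (Or.inr rfl), fun u r hu hr => hrot.shift hG hs0 hi hu hr⟩

end Simulation

/-! ### The choice of the constant, and the conclusion. -/

/-- The size of the lower bound tree is admissible if the locality is small. -/
theorem eventually_size_le {k : ℕ} (hk : 0 < k) (K B Δ : ℕ) (hK : 0 < K) (hB : 0 < B) :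
    ∃ c : ℝ, 0 < c ∧ ∀ᶠ n : ℕ in atTop, ∀ t : ℕ, (t : ℝ) < c * (n : ℝ) ^ (1 / (k : ℝ)) →
      K * ((2 * (t + 3) + 1) * B) ^ k + Δ ≤ n := by
  have hK' : (1 : ℝ) ≤ K := by exact_mod_cast hK
  have hB' : (1 : ℝ) ≤ B := by exact_mod_cast hB
  -- Once `c * y ≥ 7` for `y = n ^ (1 / k)`, one has `2 * t + 7 ≤ 3 * c * y`. With this `c` the
  -- power term is then at most `n / 2`, and the other half of `n` pays for `Δ`.
  refine ⟨1 / (6 * B * K), by positivity, ?_⟩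
  have hlim : Tendsto (fun n : ℕ => 1 / (6 * B * K) * (n : ℝ) ^ (1 / (k : ℝ))) atTop atTop :=
    ((tendsto_rpow_atTop (by positivity)).comp tendsto_natCast_atTop_atTop).const_mul_atTop
      (by positivity)
  filter_upwards [hlim.eventually_ge_atTop 7, eventually_ge_atTop (2 * Δ)] with n h7 hΔ t ht
  set y := (n : ℝ) ^ (1 / (k : ℝ)) with hy
  have hy0 : 0 ≤ y := by positivity
  have hyk : y ^ k = n := by
    rw [hy, one_div, Real.rpow_inv_natCast_pow (Nat.cast_nonneg n) hk.ne']
  have h1 : (2 * ((t : ℝ) + 3) + 1) * B ≤ 1 / (2 * K) * y := by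
    have h2 : 2 * ((t : ℝ) + 3) + 1 ≤ 3 * (1 / (6 * B * K) * y) := by linarith
    calc (2 * ((t : ℝ) + 3) + 1) * B ≤ 3 * (1 / (6 * B * K) * y) * B := by gcongr
      _ = 1 / (2 * K) * y := by field_simp; ring
  have h3 : (1 / (2 * K) : ℝ) ^ k ≤ 1 / (2 * K) :=
    pow_le_of_le_one (by positivity) (by rw [div_le_one (by positivity)]; linarith) hk.ne'
  have h4 : (K : ℝ) * ((2 * ((t : ℝ) + 3) + 1) * B) ^ k ≤ n / 2 := by
    calc (K : ℝ) * ((2 * ((t : ℝ) + 3) + 1) * B) ^ k ≤ K * (1 / (2 * K) * y) ^ k := by gcongr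
      _ = K * ((1 / (2 * K)) ^ k * n) := by rw [mul_pow, hyk]
      _ ≤ K * (1 / (2 * K) * n) := by gcongr
      _ = n / 2 := by field_simp
  have h5 : (2 * Δ : ℝ) ≤ n := by exact_mod_cast hΔ
  have h6 : (K : ℝ) * ((2 * ((t : ℝ) + 3) + 1) * B) ^ k + Δ ≤ n := by linarith
  exact_mod_cast h6

theorem mainTheorem1 {Δ : ℕ} (hΔ : 0 < Δ) {L : Type*} [Finite L] [Nonempty L]
    (P : RootedLCL Δ L) (k : ℕ) (hk : 0 < k) (hd : P.depth = (k : ℕ∞)) :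
    ∃ c : ℝ, 0 < c ∧ ∀ A : RandOnlineLocalAlgorithm L, A.Solves P →
      ∀ᶠ n : ℕ in atTop, n ≡ 1 [MOD Δ] →
        c * (n : ℝ) ^ (1 / (k : ℝ)) ≤ (A.locality n : ℝ) := by
  obtain ⟨D, hD⟩ := P.exists_trim_bound
  obtain ⟨c, hc, hev⟩ := eventually_size_le hk (k + (Δ + 1) ^ (D + 1)) ((Δ + 1) ^ (D + 2)) Δ
    (by positivity) (by positivity)
  refine ⟨c, hc, fun A hA => ?_⟩
  -- Beyond the sizes of the finitely many exceptional trees, the guarantee holds for all trees of a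
  -- given size. Only this threshold depends on the algorithm; `c` does not.
  obtain ⟨N, hN⟩ := (hA.image Sigma.fst).bddAbove
  filter_upwards [hev, eventually_gt_atTop N] with n hn hnN hmod
  by_contra! hlt
  have hgood : ∃ R C, P.IsGoodSequence (k + 1) R C := by
    refine exists_isGoodSequence_of_algorithm hΔ hk hD A hmod (hn _ hlt) fun G hG => ?_
    by_contra hbad
    exact absurd (hN ⟨⟨n, G⟩, ⟨hG, hbad⟩, rfl⟩) (not_le.2 hnN)
  have h1 : ((k + 1 : ℕ) : ℕ∞) ≤ P.depth :=
    le_iSup₂ (f := fun (k : ℕ) (_ : ∃ R C, P.IsGoodSequence k R C) => (k : ℕ∞)) (k + 1) hgood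
  rw [hd, Nat.cast_le] at h1
  omega
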